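/- \textbf{Definitions.} A labelled event structure is $\mathfrak E=(E,\preccurlyeq,\sharp,\eta,\Sigma)$, where $\preccurlyeq$ is a partial order on $E$ with $\{e'\mid e'\preccurlyeq e\}$ finite for every $e$, $\sharp$ is an irreflexive symmetric relation on $E$ with $e_1\sharp e_2\preccurlyeq e_3\Rightarrow e_1\sharp e_3$, and $\eta:E\to\Sigma$. Events $e_1,e_2$ are concurrent, $e_1\,\mathrm{co}\,e_2$, iff $e_1\not\preccurlyeq e_2$, $e_2\not\preccurlyeq e_1$ and not $e_1\sharp e_2$. Configurations are the finite, downward closed subsets of $E$ without conflicting events (equivalently, those reachable from $\emptyset$ by adding one event at a time); $C\xrightarrow{e}C'$ means that $C,C'$ are configurations, $e\notin C$ and $C'=C\cup\{e\}$. The future of $C$ is the set of events $e\notin C$ that are in conflict with no event of $C$, with the inherited $\preccurlyeq,\sharp,\eta$. The transition system with independence (TSI) of $\mathfrak E$ has the configurations as states, $\emptyset$ as initial state, the transitions $T=\{(C,a,C')\mid\exists e.\ a=\eta(e),\ C\xrightarrow{e}C'\}$, and $(C_1,a,C_1')\mathrel I(C_2,b,C_2')$ iff $C_1\xrightarrow{e_1}C_1'$,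 $C_2\xrightarrow{e_2}C_2'$, $a=\eta(e_1)$, $b=\eta(e_2)$ for some $e_1\,\mathrm{co}\,e_2$. For $t=(s,a,s')$ put $\sigma(t)=s$, $\delta(t)=a$, $\tau(t)=s'$. For transitions, $t\otimes t'$ iff $\sigma(t)=\sigma(t')$ and $t\mathrel I t'$; $t\ominus r$ iff $\tau(t)=\sigma(r)$ and $t\mathrel I r$; $t\le r$ iff $\tau(t)=\sigma(r)$ and not $t\mathrel I r$. There is also an empty transition $t_\epsilon$, with $t_\epsilon\le r$ iff $\sigma(r)$ is the initial state, and never $t_\epsilon\ominus r$. Let $\mathfrak X(s)$ be the set of all transitions with source $s$. A set of transitions with a common source is conflict-free if any two distinct elements are related by $\otimes$. Support sets are the sets $\mathfrak X(s)$ and the non-empty conflict-free sets. $M\sqsubseteq R$ means that $M\subseteq R$ is a conflict-free support set and no $t\in R\setminus M$ satisfies $t\otimes t'$ for all $t'\in M$. Let $\mathcal X$ consist of all $\mathfrak X(s)$ and all $M\sqsubseteq\mathfrak X(s)$, and let $\mathfrak S=\mathcal X\times(T\cup\{t_\epsilon\})$. Trace Fixpoint Logic (TFL) has the formulae $\phi::=Z\mid\neg\phi\mid\phi\wedge\phi\mid\langle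 a\rangle_c\phi\mid\langle a\rangle_{nc}\phi\mid\langle\otimes\rangle\phi\mid\mu Z.\phi$ with $a\in\Sigma$, where free occurrences of $Z$ in the body of $\mu Z.\phi$ are under an even number of negations. For a valuation $\mathcal V$ of the variables by subsets of $\mathfrak S$, the denotation $[\![\phi]\!]_{\mathcal V}\subseteq\mathfrak S$ is as usual for variables, Boolean operators (negation is complement in $\mathfrak S$) and least fixpoints, and: $(R,t)\in[\![\langle a\rangle_c\phi]\!]_{\mathcal V}$ (resp. $[\![\langle a\rangle_{nc}\phi]\!]_{\mathcal V}$) iff there is $r\in R$ with $\delta(r)=a$, $t\le r$ (resp. $t\ominus r$) and $(\mathfrak X(\tau(r)),r)\in[\![\phi]\!]_{\mathcal V}$; $(R,t)\in[\![\langle\otimes\rangle\phi]\!]_{\mathcal V}$ iff $(M,t)\in[\![\phi]\!]_{\mathcal V}$ for some $M\in\mathcal X$ with $M\sqsubseteq R$. A TFL specification is a closed formula; $\mathfrak E\models\phi$ iff $(\mathfrak X(\emptyset),t_\epsilon)\in[\![\phi]\!]_{\mathcal V}$ for the TSI of $\mathfrak E$ (for any $\mathcal V$). A regular quotient set representation of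 $\mathfrak E$ is an equivalence relation $\sim$ on the configurations of $\mathfrak E$ with finitely many classes, such that $C\sim D$ implies that the futures of $C$ and $D$ are isomorphic labelled event structures, and such that $\sim$ is decidable. Here events and labels are numbered by natural numbers, and $(\mathfrak E,\sim)$ is presented by three programs: one that lists, for a configuration $C$ (given as a list of its events), the finitely many events $e$ with $C\xrightarrow{e}C\cup\{e\}$; one that computes $\eta$; and one that decides $\sim$. \textbf{Theorem.} The model-checking problem for event structures represented as regular quotient sets against TFL specifications is decidable: there is one algorithm which, given programs that present an event structure $\mathfrak E$ as a regular quotient set (with respect to some $\sim$) and given a TFL specification $\phi$, halts and answers correctly whether $\mathfrak E\models\phi$. -/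

import Mathlib

universe u v

/-! ### Transition systems with independence -/

/-- A transition `(s, a, s')` over the states `S` and the labels `L`. -/
abbrev LTrans (S : Type u) (L : Type v) := S × L × S

namespace LTrans

variable {S : Type u} {L : Type v}

/-- The source `σ(t)`. -/
def src (t : LTrans S L) : S := t.1

/-- The label `δ(t)`. -/
def lab (t : LTrans S L) : L := t.2.1

/-- The target `τ(t)`. -/
def tgt (t : LTrans S L) : S := t.2.2

/-- `(s,a,s₁) ≺ (s₂,a,q)`: two instances of one action, separated by an independent action `b`. -/
def Prec (I : LTrans S L → LTrans S L → Prop) (t u : LTrans S L) : Prop :=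
  t.lab = u.lab ∧
    ∃ b : L, I t (t.src, b, u.src) ∧ I t (t.tgt, b, u.tgt) ∧ I (t.src, b, u.src) u

end LTrans

/-- A transition system with independence (the label set is the type `L`). -/
structure TSI (S : Type u) (L : Type v) where
  /-- the initial state -/
  init : S
  /-- the transition relation -/
  T : Set (LTrans S L)
  /-- the independence relation -/
  I : LTrans S L → LTrans S L → Prop
  I_mem : ∀ {t t'}, I t t' → t ∈ T ∧ t' ∈ T
  I_irrefl : ∀ t, ¬ I t t
  I_symm : ∀ {t t'}, I t t' → I t' t
  A1 : ∀ {s a s₁ s₂}, Relation.EqvGen (LTrans.Prec I) (s, a, s₁) (s, a, s₂) → s₁ = s₂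
  A2 : ∀ {s a s₁ b s₂}, I (s, a, s₁) (s, b, s₂) →
    ∃ q, I (s, a, s₁) (s₁, b, q) ∧ I (s, b, s₂) (s₂, a, q)
  A3 : ∀ {s a s₁ b q}, I (s, a, s₁) (s₁, b, q) →
    ∃ s₂, I (s, a, s₁) (s, b, s₂) ∧ I (s, b, s₂) (s₂, a, q)
  A4 : ∀ {t u w}, (LTrans.Prec I t u ∨ LTrans.Prec I u t) → I u w → I t w

/-! ### Trace Fixpoint Logic: formulae -/

/-- Formulae of Trace Fixpoint Logic over the labels `L`, with variables numbered by `ℕ`. -/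
inductive TFL (L : Type v) : Type v
  | var (Z : ℕ) : TFL L
  | neg (φ : TFL L) : TFL L
  | and (φ ψ : TFL L) : TFL L
  /-- the causal diamond `⟨a⟩_c φ` -/
  | diaC (a : L) (φ : TFL L) : TFL L
  /-- the non-causal diamond `⟨a⟩_nc φ` -/
  | diaNC (a : L) (φ : TFL L) : TFL L
  /-- the trace diamond `⟨⊗⟩ φ` -/
  | diaT (φ : TFL L) : TFL L
  /-- the least fixpoint `μ Z. φ` -/
  | mu (Z : ℕ) (φ : TFL L) : TFL L

namespace TFL

variable {L : Type v}

/-- Every free occurrence of `Z` lies under an even (`b = true`) or odd (`b = false`) number of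
negations. -/
def Polar (Z : ℕ) : Bool → TFL L → Prop
  | b, var Y => Y = Z → b = true
  | b, neg φ => Polar Z (!b) φ
  | b, and φ ψ => Polar Z b φ ∧ Polar Z b ψ
  | b, diaC _ φ => Polar Z b φ
  | b, diaNC _ φ => Polar Z b φ
  | b, diaT φ => Polar Z b φ
  | b, mu Y φ => Y = Z ∨ Polar Z b φ

/-- The restriction of the grammar: in `μ Z. φ`, free occurrences of `Z` in `φ` are positive. -/
def WellFormed : TFL L → Prop
  | var _ => True
  | neg φ => WellFormed φ
  | and φ ψ => WellFormed φ ∧ WellFormed ψ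
  | diaC _ φ => WellFormed φ
  | diaNC _ φ => WellFormed φ
  | diaT φ => WellFormed φ
  | mu Z φ => Polar Z true φ ∧ WellFormed φ

/-- The free variables of a formula. -/
def freeVars : TFL L → Set ℕ
  | var Z => {Z}
  | neg φ => freeVars φ
  | and φ ψ => freeVars φ ∪ freeVars ψ
  | diaC _ φ => freeVars φ
  | diaNC _ φ => freeVars φ
  | diaT φ => freeVars φ
  | mu Z φ => freeVars φ \ {Z}

/-- A closed formula. -/
def Closed (φ : TFL L) : Prop := φ.freeVars = ∅

/-- The Gödel number of a formula, relative to the given numbering of the labels. -/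
def code [Encodable L] : TFL L → ℕ
  | var Z => Nat.pair 0 Z
  | neg φ => Nat.pair 1 (code φ)
  | and φ ψ => Nat.pair 2 (Nat.pair (code φ) (code ψ))
  | diaC a φ => Nat.pair 3 (Nat.pair (Encodable.encode a) (code φ))
  | diaNC a φ => Nat.pair 4 (Nat.pair (Encodable.encode a) (code φ))
  | diaT φ => Nat.pair 5 (code φ)
  | mu Z φ => Nat.pair 6 (Nat.pair Z (code φ))

end TFL

/-! ### Trace Fixpoint Logic: semantics over a TSI -/

namespace TSI

variable {S : Type u} {L : Type v} (𝔗 : TSI S L)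

/-- Immediate concurrency `t ⊗ t'`. -/
def ImmConc (t t' : LTrans S L) : Prop :=
  t ∈ 𝔗.T ∧ t' ∈ 𝔗.T ∧ t.src = t'.src ∧ 𝔗.I t t'

/-- The elements of `𝔄 = T ∪ {t_ε}`; `none` is the empty transition `t_ε`. -/
def IsAct : Option (LTrans S L) → Prop
  | none => True
  | some t => t ∈ 𝔗.T

/-- Causal dependence `t ≤ r`, with `t_ε ≤ r` for the transitions `r` that leave the initial
state. -/
def Causal : Option (LTrans S L) → LTrans S L → Prop
  | none, r => r ∈ 𝔗.T ∧ r.src = 𝔗.init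
  | some t, r => t ∈ 𝔗.T ∧ r ∈ 𝔗.T ∧ t.tgt = r.src ∧ ¬ 𝔗.I t r

/-- Linearised concurrency `t ⊖ r`. -/
def LinConc : Option (LTrans S L) → LTrans S L → Prop
  | none, _ => False
  | some t, r => t ∈ 𝔗.T ∧ r ∈ 𝔗.T ∧ t.tgt = r.src ∧ 𝔗.I t r

/-- The maximal set `𝔛(s)` of all transitions with source `s`. -/
def maxSet (s : S) : Set (LTrans S L) := {t | t ∈ 𝔗.T ∧ t.src = s}

/-- Conflict-free sets of transitions. -/
def ConflictFree (P : Set (LTrans S L)) : Prop :=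
  (∃ s, P ⊆ 𝔗.maxSet s) ∧ ∀ t ∈ P, ∀ t' ∈ P, t ≠ t' → 𝔗.ImmConc t t'

/-- Support sets: maximal sets and non-empty conflict-free sets. -/
def IsSupport (R : Set (LTrans S L)) : Prop :=
  (∃ s, R = 𝔗.maxSet s) ∨ (R.Nonempty ∧ 𝔗.ConflictFree R)

/-- `M ⊑ R`: the conflict-free support set `M` is a complete trace of `R`. -/
def CompleteTrace (M R : Set (LTrans S L)) : Prop :=
  𝔗.IsSupport M ∧ 𝔗.ConflictFree M ∧ M ⊆ R ∧ ¬ ∃ t ∈ R \ M, ∀ t' ∈ M, 𝔗.ImmConc t t'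

/-- The set `𝒳` of maximal sets and maximal traces. -/
def maximalSupports : Set (Set (LTrans S L)) :=
  {R | ∃ s, R = 𝔗.maxSet s ∨ 𝔗.CompleteTrace R (𝔗.maxSet s)}

/-- Candidates `(R, t)` for processes: a set of transitions and a transition or `t_ε`. -/
abbrev Proc (S : Type u) (L : Type v) := Set (LTrans S L) × Option (LTrans S L)

/-- The stateless maximal process space `𝔖 = 𝒳 × 𝔄`. -/
def procSpace : Set (Proc S L) := {H | H.1 ∈ 𝔗.maximalSupports ∧ 𝔗.IsAct H.2}

/-- The initial process `(𝔛(s₀), t_ε)`. -/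
def initProc : Proc S L := (𝔗.maxSet 𝔗.init, none)

/-- Valuations `𝒱 : Var → 2^𝔖`. -/
def IsValuation (V : ℕ → Set (Proc S L)) : Prop := ∀ Z, V Z ⊆ 𝔗.procSpace

/-- The denotation of a formula. -/
def denot : TFL L → (ℕ → Set (Proc S L)) → Set (Proc S L)
  | .var Z, V => V Z
  | .neg φ, V => 𝔗.procSpace \ denot φ V
  | .and φ ψ, V => denot φ V ∩ denot ψ V
  | .diaC a φ, V => {H | H ∈ 𝔗.procSpace ∧
      ∃ r ∈ H.1, r.lab = a ∧ 𝔗.Causal H.2 r ∧ (𝔗.maxSet r.tgt, some r) ∈ denot φ V}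
  | .diaNC a φ, V => {H | H ∈ 𝔗.procSpace ∧
      ∃ r ∈ H.1, r.lab = a ∧ 𝔗.LinConc H.2 r ∧ (𝔗.maxSet r.tgt, some r) ∈ denot φ V}
  | .diaT φ, V => {H | H ∈ 𝔗.procSpace ∧
      ∃ M ∈ 𝔗.maximalSupports, 𝔗.CompleteTrace M H.1 ∧ (M, H.2) ∈ denot φ V}
  | .mu Z φ, V => ⋂₀ {Q | Q ⊆ 𝔗.procSpace ∧ denot φ (Function.update V Z Q) ⊆ Q}

end TSI

/-! ### Event structures -/

/-- A labelled event structure with events `E` and labels `L`. -/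
structure EventStructure (E : Type u) (L : Type v) where
  /-- causal dependency -/
  le : E → E → Prop
  /-- conflict -/
  conflict : E → E → Prop
  /-- the labelling -/
  lab : E → L
  le_refl : ∀ e, le e e
  le_trans : ∀ {e₁ e₂ e₃}, le e₁ e₂ → le e₂ e₃ → le e₁ e₃
  le_antisymm : ∀ {e₁ e₂}, le e₁ e₂ → le e₂ e₁ → e₁ = e₂
  conflict_irrefl : ∀ e, ¬ conflict e e
  conflict_symm : ∀ {e₁ e₂}, conflict e₁ e₂ → conflict e₂ e₁
  conflict_inherit : ∀ {e₁ e₂ e₃}, conflict e₁ e₂ → le e₂ e₃ → conflict e₁ e₃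
  finite_causes : ∀ e, {e' | le e' e}.Finite

namespace EventStructure

variable {E : Type u} {L : Type v} (𝓔 : EventStructure E L)

/-- The concurrency relation `co`. -/
def Co (e₁ e₂ : E) : Prop := ¬ 𝓔.le e₁ e₂ ∧ ¬ 𝓔.le e₂ e₁ ∧ ¬ 𝓔.conflict e₁ e₂

/-- Conflict-free and causally closed sets of events. -/
def IsConf (C : Set E) : Prop :=
  (∀ e₁ ∈ C, ∀ e₂ ∈ C, ¬ 𝓔.conflict e₁ e₂) ∧ ∀ e ∈ C, ∀ e', 𝓔.le e' e → e' ∈ C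

/-- `C --e--> C'`: the configuration `C'` is obtained from `C` by adding the new event `e`. -/
def Step (C : Set E) (e : E) (C' : Set E) : Prop :=
  𝓔.IsConf C ∧ 𝓔.IsConf C' ∧ e ∉ C ∧ C' = insert e C

/-- The configurations reachable from `∅` (these are the finite configurations). -/
def Conf : Type u :=
  {C : Set E // Relation.ReflTransGen (fun X Y => ∃ e, 𝓔.Step X e Y) ∅ C}

/-- The initial configuration. -/
def initConf : 𝓔.Conf := ⟨∅, Relation.ReflTransGen.refl⟩

theorem Step.conf {𝓔 : EventStructure E L} {C C' : Set E} {e : E} (h : 𝓔.Step C e C')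
    (hC : Relation.ReflTransGen (fun X Y => ∃ e, 𝓔.Step X e Y) ∅ C) :
    Relation.ReflTransGen (fun X Y => ∃ e, 𝓔.Step X e Y) ∅ C' := hC.tail ⟨e, h⟩

/-- The event of a step is determined by its source and target. -/
theorem Step.unique {𝓔 : EventStructure E L} {C C' : Set E} {e f : E}
    (h : 𝓔.Step C e C') (h' : 𝓔.Step C f C') : e = f := by
  have : e ∈ C' := by rw [h.2.2.2]; exact Set.mem_insert _ _
  rw [h'.2.2.2] at this
  rcases this with h1 | h1
  · exact h1
  · exact absurd h1 h.2.2.1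

/-- The transitions of the TSI of an event structure. -/
def tsiT : Set (LTrans 𝓔.Conf L) := {t | ∃ e, t.lab = 𝓔.lab e ∧ 𝓔.Step t.src.1 e t.tgt.1}

/-- The independence relation of the TSI of an event structure. -/
def tsiI (t t' : LTrans 𝓔.Conf L) : Prop :=
  ∃ e₁ e₂, 𝓔.Co e₁ e₂ ∧ t.lab = 𝓔.lab e₁ ∧ t'.lab = 𝓔.lab e₂ ∧
    𝓔.Step t.src.1 e₁ t.tgt.1 ∧ 𝓔.Step t'.src.1 e₂ t'.tgt.1

theorem Co.symm {𝓔 : EventStructure E L} {e f : E} (h : 𝓔.Co e f) : 𝓔.Co f e :=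
  ⟨h.2.1, h.1, fun h' => h.2.2 (𝓔.conflict_symm h')⟩

theorem Co.ne {𝓔 : EventStructure E L} {e f : E} (h : 𝓔.Co e f) : e ≠ f := by
  rintro rfl; exact h.1 (𝓔.le_refl _)

/-- Transitions related by `≺` are occurrences of the same event. -/
theorem prec_event {t u : LTrans 𝓔.Conf L} (h : LTrans.Prec 𝓔.tsiI t u) :
    ∃ e, t.lab = 𝓔.lab e ∧ 𝓔.Step t.src.1 e t.tgt.1 ∧ 𝓔.Step u.src.1 e u.tgt.1 := by
  obtain ⟨hl, b, ⟨e₁, e₂, hco, h1, h2, h3, h4⟩, ⟨e₁', e₃, -, -, -, h5, h6⟩,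
    ⟨e₂', e₄, hco', -, -, h7, h8⟩⟩ := h
  simp only [LTrans.src, LTrans.tgt] at *
  refine ⟨e₁, h1, h3, ?_⟩
  have hmem : e₁ ∈ u.2.2.1 := by
    rw [h6.2.2.2, h3.2.2.2]; exact Or.inr (Or.inl rfl)
  rw [h8.2.2.2] at hmem
  rcases hmem with h9 | h9
  · rw [h9]; exact h8
  · rw [h4.2.2.2] at h9
    rcases h9 with h9 | h9
    · exact absurd h9 hco.ne
    · exact absurd h9 h3.2.2.1

theorem eqvGen_event {t u : LTrans 𝓔.Conf L} (h : Relation.EqvGen (LTrans.Prec 𝓔.tsiI) t u) :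
    ∀ e, 𝓔.Step t.src.1 e t.tgt.1 ↔ 𝓔.Step u.src.1 e u.tgt.1 := by
  induction h with
  | rel x y h =>
    obtain ⟨e, -, h1, h2⟩ := 𝓔.prec_event h
    intro f
    constructor
    · intro h3; rw [h3.unique h1]; exact h2
    · intro h3; rw [h3.unique h2]; exact h1
  | refl x => exact fun _ => Iff.rfl
  | symm x y _ ih => exact fun e => (ih e).symm
  | trans x y z _ _ ih1 ih2 => exact fun e => (ih1 e).trans (ih2 e)

/-- A triple that is not a transition is related to itself only. -/
theorem eqvGen_eq_of_not_step {s s₁ s₂ : 𝓔.Conf} {a : L}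
    (h : Relation.EqvGen (LTrans.Prec 𝓔.tsiI) (s, a, s₁) (s, a, s₂))
    (hT : ¬ ∃ e, 𝓔.Step s.1 e s₁.1) : s₁ = s₂ := by
  have key : ∀ {t u : LTrans 𝓔.Conf L}, Relation.EqvGen (LTrans.Prec 𝓔.tsiI) t u →
      t = u ∨ ∃ e, 𝓔.Step t.src.1 e t.tgt.1 := by
    intro t u h
    induction h with
    | rel x y h => obtain ⟨e, -, h1, -⟩ := 𝓔.prec_event h; exact Or.inr ⟨e, h1⟩
    | refl x => exact Or.inl rfl
    | symm x y hxy ih =>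
      rcases ih with rfl | ⟨e, he⟩
      · exact Or.inl rfl
      · exact Or.inr ⟨e, (𝓔.eqvGen_event hxy e).1 he⟩
    | trans x y z hxy _ ih1 ih2 =>
      rcases ih1 with rfl | h
      · exact ih2
      · exact Or.inr h
  rcases key h with h | h
  · exact congrArg (fun t : LTrans 𝓔.Conf L => t.2.2) h
  · exact absurd h hT

/-- Two concurrent events enabled at `C` can be executed one after the other. -/
theorem step_diamond {C C₁ C₂ : Set E} {e₁ e₂ : E} (h1 : 𝓔.Step C e₁ C₁) (h2 : 𝓔.Step C e₂ C₂)
    (hco : 𝓔.Co e₁ e₂) : 𝓔.Step C₁ e₂ (insert e₂ C₁) := by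
  refine ⟨h1.2.1, ⟨?_, ?_⟩, ?_, rfl⟩
  · have hx : ∀ x ∈ C₁, ¬ 𝓔.conflict e₂ x := by
      intro x hx
      rw [h1.2.2.2] at hx
      rcases hx with rfl | hx
      · exact hco.symm.2.2
      · exact h2.2.1.1 e₂ (by rw [h2.2.2.2]; exact Or.inl rfl) x
          (by rw [h2.2.2.2]; exact Or.inr hx)
    rintro x (rfl | hx') y (rfl | hy')
    · exact 𝓔.conflict_irrefl _
    · exact hx y hy'
    · exact fun h => hx x hx' (𝓔.conflict_symm h)
    · exact h1.2.1.1 x hx' y hy'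
  · rintro x (rfl | hx) y hy
    · have := h2.2.1.2 x (by rw [h2.2.2.2]; exact Or.inl rfl) y hy
      rw [h2.2.2.2] at this
      rcases this with rfl | h
      · exact Or.inl rfl
      · exact Or.inr (by rw [h1.2.2.2]; exact Or.inr h)
    · exact Or.inr (h1.2.1.2 x hx y hy)
  · intro h
    rw [h1.2.2.2] at h
    rcases h with h | h
    · exact hco.ne h.symm
    · exact h2.2.2.1 h

/-- An event enabled after `e₁` and concurrent with it is enabled before `e₁`. -/
theorem step_back {C C₁ Q : Set E} {e₁ e₂ : E} (h1 : 𝓔.Step C e₁ C₁) (h2 : 𝓔.Step C₁ e₂ Q)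
    (hco : 𝓔.Co e₁ e₂) : 𝓔.Step C e₂ (insert e₂ C) := by
  have hsub : C ⊆ C₁ := by rw [h1.2.2.2]; exact Set.subset_insert _ _
  have hQ : insert e₂ C ⊆ Q := by rw [h2.2.2.2]; exact Set.insert_subset_insert hsub
  refine ⟨h1.1, ⟨fun x hx y hy => h2.2.1.1 x (hQ hx) y (hQ hy), ?_⟩,
    fun h => h2.2.2.1 (hsub h), rfl⟩
  rintro x (rfl | hx) y hy
  · have := h2.2.1.2 x (hQ (Or.inl rfl)) y hy
    rw [h2.2.2.2, h1.2.2.2] at this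
    rcases this with rfl | rfl | h
    · exact Or.inl rfl
    · exact absurd hy hco.1
    · exact Or.inr h
  · exact Or.inr (h1.1.2 x hx y hy)

/-- The TSI determined by an event structure. -/
def toTSI : TSI 𝓔.Conf L where
  init := 𝓔.initConf
  T := 𝓔.tsiT
  I := 𝓔.tsiI
  I_mem := by
    rintro t t' ⟨e₁, e₂, -, h1, h2, h3, h4⟩
    exact ⟨⟨e₁, h1, h3⟩, ⟨e₂, h2, h4⟩⟩
  I_irrefl := by
    rintro t ⟨e₁, e₂, hco, -, -, h3, h4⟩
    exact hco.ne (h3.unique h4)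
  I_symm := by
    rintro t t' ⟨e₁, e₂, hco, h1, h2, h3, h4⟩
    exact ⟨e₂, e₁, hco.symm, h2, h1, h4, h3⟩
  A1 := by
    intro s a s₁ s₂ h
    by_cases hT : ∃ e, 𝓔.Step s.1 e s₁.1
    · obtain ⟨e, he⟩ := hT
      have he' : 𝓔.Step s.1 e s₂.1 := (𝓔.eqvGen_event h e).1 he
      exact Subtype.ext (he.2.2.2.trans he'.2.2.2.symm)
    · rw [𝓔.eqvGen_eq_of_not_step h hT]
  A2 := by
    rintro s a s₁ b s₂ ⟨e₁, e₂, hco, h1, h2, h3, h4⟩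
    have d1 := 𝓔.step_diamond h3 h4 hco
    have d2 := 𝓔.step_diamond h4 h3 hco.symm
    have hq : insert e₁ s₂.1 = insert e₂ s₁.1 := by
      have e3 := h3.2.2.2
      have e4 := h4.2.2.2
      simp only [LTrans.src, LTrans.tgt] at e3 e4
      rw [e3, e4, Set.insert_comm]
    refine ⟨⟨insert e₂ s₁.1, d1.conf s₁.2⟩, ⟨e₁, e₂, hco, h1, h2, h3, d1⟩,
      ⟨e₂, e₁, hco.symm, h2, h1, h4, ?_⟩⟩
    have := d2
    simp only [LTrans.src, LTrans.tgt] at this ⊢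
    rw [hq] at this
    exact this
  A3 := by
    rintro s a s₁ b q ⟨e₁, e₂, hco, h1, h2, h3, h4⟩
    have d1 := 𝓔.step_back h3 h4 hco
    have d2 := 𝓔.step_diamond d1 h3 hco.symm
    refine ⟨⟨insert e₂ s.1, d1.conf s.2⟩, ⟨e₁, e₂, hco, h1, h2, h3, d1⟩,
      ⟨e₂, e₁, hco.symm, h2, h1, d1, ?_⟩⟩
    have hq : insert e₁ (insert e₂ s.1) = q.1 := by
      have e3 := h3.2.2.2
      have e4 := h4.2.2.2
      simp only [LTrans.src, LTrans.tgt] at e3 e4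
      rw [e4, e3, Set.insert_comm]
    simp only [LTrans.src, LTrans.tgt] at d2 ⊢
    rw [hq] at d2
    exact d2
  A4 := by
    rintro t u w h ⟨e₁, e₂, hco, h1, h2, h3, h4⟩
    rcases h with h | h
    · obtain ⟨e, h5, h6, h7⟩ := 𝓔.prec_event h
      obtain rfl := h3.unique h7
      exact ⟨e₁, e₂, hco, h5, h2, h6, h4⟩
    · obtain ⟨e, h5, h6, h7⟩ := 𝓔.prec_event h
      obtain rfl := h3.unique h6
      exact ⟨e₁, e₂, hco, h.1 ▸ h5, h2, h7, h4⟩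

/-- The future of `C`: the events outside `C` that are not in conflict with an event of `C`. -/
def future (C : Set E) : Set E := {e | e ∉ C ∧ ∀ c ∈ C, ¬ 𝓔.conflict c e}

/-- The futures of `C` and `D` are isomorphic labelled event structures. -/
def SameFuture (C D : Set E) : Prop :=
  ∃ f : 𝓔.future C ≃ 𝓔.future D, ∀ e e' : 𝓔.future C,
    (𝓔.le e e' ↔ 𝓔.le (f e) (f e')) ∧
    (𝓔.conflict e e' ↔ 𝓔.conflict (f e) (f e')) ∧
    𝓔.lab (f e) = 𝓔.lab e

/-- The events enabled at `C`, that is, those leading to a next configuration. -/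
def enabled (C : Set E) : Set E := {e | ∃ C', 𝓔.Step C e C'}

/-- A quotient set representation of an event structure with finitely many classes: an equivalence
relation on configurations, of finite index, that identifies only configurations with isomorphic
futures. -/
structure FiniteQuotient where
  /-- the equivalence relation on configurations -/
  rel : Setoid 𝓔.Conf
  finite_classes : Finite (Quotient rel)
  sameFuture : ∀ C D : 𝓔.Conf, rel C D → 𝓔.SameFuture C.1 D.1

end EventStructure

/-! ### Effective presentations -/

/-- The list `l` of numbers lists the members of `A`, in any order and with possible
repetitions. -/
def ListsSet {E : Type u} [Encodable E] (l : List ℕ) (A : Set E) : Prop :=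
  ∀ n, n ∈ l ↔ ∃ e ∈ A, Encodable.encode e = n

/-- Three programs: for the next events, for the labels, and for the equivalence of
configurations. -/
abbrev Programs := Nat.Partrec.Code × Nat.Partrec.Code × Nat.Partrec.Code

/-- The programs `p` present the event structure `𝓔` as a regular quotient set with respect to the
finite quotient `q`: the first lists the (finitely many) events enabled at a given configuration,
the second computes the label of an event, the third decides the equivalence relation. -/
structure IsPresentation {E : Type u} {L : Type v} [Encodable E] [Encodable L] (p : Programs)
    (𝓔 : EventStructure E L) (q : 𝓔.FiniteQuotient) : Prop where
  next : ∀ (C : 𝓔.Conf) (l : List ℕ), ListsSet l C.1 →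
    ∃ l' : List ℕ, Encodable.encode l' ∈ p.1.eval (Encodable.encode l) ∧
      ListsSet l' (𝓔.enabled C.1)
  label : ∀ e : E, Encodable.encode (𝓔.lab e) ∈ p.2.1.eval (Encodable.encode e)
  equiv : ∀ (C D : 𝓔.Conf) (l m : List ℕ), ListsSet l C.1 → ListsSet m D.1 →
    (q.rel C D → 1 ∈ p.2.2.eval (Encodable.encode (l, m))) ∧
    (¬ q.rel C D → 0 ∈ p.2.2.eval (Encodable.encode (l, m)))

/-! The truth of a formula at a process `(R, t)` with `R` located at the target of `t` depends on
little: the future of that target up to isomorphism, the enabled events that occur in `R`, and the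
enabled events that are independent of `t`. By `co_iff_of_steps` the latter are those already
enabled at the source of `t`. These data form a `Node`. Isomorphisms of futures that respect the two
sets of events are a bisimulation between nodes (`Node.Equiv.bisim`), so local processes map to
classes of nodes by a bounded morphism (`morphism_cls_nodeOf`), and bounded morphisms preserve
fixpoint formulae (`Morphism.sem`). The restriction to local processes is needed because `𝔖` also
contains pairs whose components are unrelated; it is harmless because the initial process is local
and locality is inherited by successors.

Only finitely many classes of nodes exist. Finiteness of `∼` gives an `n` such that every path of
length at most `n + 1` is equivalent to one of length at most `n`. Composing isomorphisms, every
configuration then has the future of one reached within `n` steps (`exists_path_futIso`); steps need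
not respect `∼`. This yields a computable bound `K` on the number of classes (`card_nodeClass_le`),
and least fixpoints may be replaced by their `K`-th approximants (`sem_unfold`).

What remains is a formula without fixpoints. Its truth at the initial node depends only on paths of
bounded length, and its Gödel number serves as such a bound. It is therefore evaluated directly on
paths, without constructing the quotient (`mem_evalCode_iff`). Conflict and independence of enabled
events can be read off the lists of next events.

The algorithm searches for a step bound `k` and a length `n` for which all the required computations
finish and the covering test succeeds. Every accepted pair gives the right answer
(`modelCheck_sound`), and some pair is accepted (`modelCheck_complete`). -/

/-! ### Modal frames -/

/-- A Kripke frame for the modalities of Trace Fixpoint Logic, with a domain relative to which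
negation is interpreted. The index `some (true, a)` is that of `⟨a⟩_c`, `some (false, a)` that of
`⟨a⟩_nc` and `none` that of `⟨⊗⟩`. -/
structure ModalFrame (L : Type v) (W : Type*) where
  /-- the domain -/
  dom : Set W
  /-- the accessibility relations -/
  rel : Option (Bool × L) → W → W → Prop

namespace ModalFrame

variable {L : Type v} {W : Type*} (F : ModalFrame L W)

/-- The diamond of a modality. -/
def dia (m : Option (Bool × L)) (X : Set W) : Set W := {w | ∃ w', F.rel m w w' ∧ w' ∈ X}

/-- The denotation of a formula in a modal frame. -/
def sem : TFL L → (ℕ → Set W) → Set W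
  | .var Z, V => V Z
  | .neg φ, V => F.dom \ sem φ V
  | .and φ ψ, V => sem φ V ∩ sem ψ V
  | .diaC a φ, V => F.dia (some (true, a)) (sem φ V)
  | .diaNC a φ, V => F.dia (some (false, a)) (sem φ V)
  | .diaT φ, V => F.dia none (sem φ V)
  | .mu Z φ, V => ⋂₀ {Q | Q ⊆ F.dom ∧ sem φ (Function.update V Z Q) ⊆ Q}

variable {F}

theorem dia_mono {m : Option (Bool × L)} {X Y : Set W} (h : X ⊆ Y) : F.dia m X ⊆ F.dia m Y :=
  fun _ ⟨w', h1, h2⟩ => ⟨w', h1, h h2⟩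

/-- Monotonicity in the variables of positive polarity, antitonicity in those of negative
polarity. -/
theorem sem_polar {Z : ℕ} {X Y : Set W} (h : X ⊆ Y) (φ : TFL L) :
    ∀ (b : Bool) (V : ℕ → Set W), TFL.Polar Z b φ →
      if b then F.sem φ (Function.update V Z X) ⊆ F.sem φ (Function.update V Z Y)
      else F.sem φ (Function.update V Z Y) ⊆ F.sem φ (Function.update V Z X) := by
  induction φ with
  | var T =>
    intro b V hp
    by_cases hT : T = Z
    · subst hT
      simp [hp rfl, sem, h]
    · simp [sem, Function.update_of_ne hT]
  | neg φ ih =>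
    intro b V hp
    have := ih (!b) V hp
    cases b
    · exact Set.sdiff_subset_sdiff_right this
    · exact Set.sdiff_subset_sdiff_right this
  | and φ ψ ih₁ ih₂ =>
    intro b V hp
    have h₁ := ih₁ b V hp.1
    have h₂ := ih₂ b V hp.2
    cases b <;> exact Set.inter_subset_inter h₁ h₂
  | diaC a φ ih => intro b V hp; have := ih b V hp; cases b <;> exact dia_mono this
  | diaNC a φ ih => intro b V hp; have := ih b V hp; cases b <;> exact dia_mono this
  | diaT φ ih => intro b V hp; have := ih b V hp; cases b <;> exact dia_mono this
  | mu T φ ih =>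
    intro b V hp
    by_cases hT : T = Z
    · subst hT
      simp [sem]
    · have hp' := hp.resolve_left hT
      have hc := fun Q : Set W => ih b (Function.update V T Q) hp'
      simp only [Function.update_comm hT] at hc
      cases b
      · exact Set.sInter_subset_sInter fun Q hQ => ⟨hQ.1, (hc Q).trans hQ.2⟩
      · exact Set.sInter_subset_sInter fun Q hQ => ⟨hQ.1, (hc Q).trans hQ.2⟩

theorem sem_mono {Z : ℕ} {φ : TFL L} (hp : TFL.Polar Z true φ) (V : ℕ → Set W) :
    Monotone fun X => F.sem φ (Function.update V Z X) :=
  fun _ _ h => sem_polar h φ true V hp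

/-- The denotation depends on the free variables only. -/
theorem sem_congr (φ : TFL L) : ∀ V V' : ℕ → Set W, (∀ Z ∈ φ.freeVars, V Z = V' Z) →
    F.sem φ V = F.sem φ V' := by
  induction φ with
  | var T => intro V V' h; exact h T rfl
  | neg φ ih => intro V V' h; simp only [sem]; rw [ih V V' h]
  | and φ ψ ih₁ ih₂ =>
    intro V V' h
    simp only [sem]
    rw [ih₁ V V' fun Z hZ => h Z (Or.inl hZ), ih₂ V V' fun Z hZ => h Z (Or.inr hZ)]
  | diaC a φ ih => intro V V' h; simp only [sem]; rw [ih V V' h]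
  | diaNC a φ ih => intro V V' h; simp only [sem]; rw [ih V V' h]
  | diaT φ ih => intro V V' h; simp only [sem]; rw [ih V V' h]
  | mu T φ ih =>
    intro V V' h
    have : ∀ Q, F.sem φ (Function.update V T Q) = F.sem φ (Function.update V' T Q) := by
      intro Q
      apply ih
      intro Z hZ
      by_cases hT : Z = T
      · subst hT; simp
      · simpa [Function.update_of_ne hT] using h Z ⟨hZ, hT⟩
    simp only [sem, this]

/-- For `mu`, the whole domain is a prefixpoint. Prefixpoints are required to lie in the domain, so
`Morphism.sem` needs this bound for the prefixpoint that it builds. -/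
theorem sem_subset_dom (hF : ∀ m w w', F.rel m w w' → w ∈ F.dom) (φ : TFL L) :
    ∀ V : ℕ → Set W, (∀ Z, V Z ⊆ F.dom) → F.sem φ V ⊆ F.dom := by
  induction φ with
  | var T => intro V h; exact h T
  | neg φ _ => intro V _; exact Set.sdiff_subset
  | and φ ψ ih₁ _ => intro V h; exact Set.inter_subset_left.trans (ih₁ V h)
  | diaC a φ _ => rintro V _ w ⟨w', h, _⟩; exact hF _ _ _ h
  | diaNC a φ _ => rintro V _ w ⟨w', h, _⟩; exact hF _ _ _ h
  | diaT φ _ => rintro V _ w ⟨w', h, _⟩; exact hF _ _ _ h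
  | mu T φ ih =>
    intro V h
    refine Set.sInter_subset_of_mem ⟨subset_rfl, ih _ fun Z => ?_⟩
    by_cases hT : Z = T
    · subst hT; simp
    · simpa [Function.update_of_ne hT] using h Z

/-- A bounded morphism `π`, defined on a part `G` of the domain of `F` that is closed under
accessibility, to a frame `F'` in which all points belong to the domain. -/
structure Morphism {W' : Type*} (F : ModalFrame L W) (F' : ModalFrame L W') (G : Set W)
    (π : W → W') : Prop where
  rel_dom : ∀ m w w', F.rel m w w' → w ∈ F.dom
  sub : G ⊆ F.dom
  total : F'.dom = Set.univ
  forth : ∀ m w w', w ∈ G → F.rel m w w' → w' ∈ G ∧ F'.rel m (π w) (π w')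
  back : ∀ m w q, w ∈ G → F'.rel m (π w) q → ∃ w' ∈ G, F.rel m w w' ∧ π w' = q

theorem Morphism.dia {W' : Type*} {F' : ModalFrame L W'} {G : Set W} {π : W → W'}
    (h : Morphism F F' G π) (m : Option (Bool × L)) {X : Set W} {X' : Set W'}
    (hX : ∀ w ∈ G, w ∈ X ↔ π w ∈ X') : ∀ w ∈ G, w ∈ F.dia m X ↔ π w ∈ F'.dia m X' := by
  intro w hw
  constructor
  · rintro ⟨w', h1, h2⟩
    obtain ⟨h3, h4⟩ := h.forth m w w' hw h1
    exact ⟨π w', h4, (hX w' h3).1 h2⟩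
  · rintro ⟨q, h1, h2⟩
    obtain ⟨w', h3, h4, rfl⟩ := h.back m w q hw h1
    exact ⟨w', h4, (hX w' h3).2 h2⟩

/-- Bounded morphisms preserve and reflect satisfaction. -/
theorem Morphism.sem {W' : Type*} {F' : ModalFrame L W'} {G : Set W} {π : W → W'}
    (h : Morphism F F' G π) (φ : TFL L) : φ.WellFormed →
    ∀ (V : ℕ → Set W) (V' : ℕ → Set W'), (∀ Z, V Z ⊆ F.dom) →
      (∀ Z, ∀ w ∈ G, w ∈ V Z ↔ π w ∈ V' Z) → ∀ w ∈ G, w ∈ F.sem φ V ↔ π w ∈ F'.sem φ V' := by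
  induction φ with
  | var T => intro _ V V' _ hV; exact hV T
  | neg φ ih =>
    intro wf V V' hd hV w hw
    simp only [ModalFrame.sem, Set.mem_sdiff, ih wf V V' hd hV w hw, h.total, Set.mem_univ,
      h.sub hw]
  | and φ ψ ih₁ ih₂ =>
    intro wf V V' hd hV w hw
    exact and_congr (ih₁ wf.1 V V' hd hV w hw) (ih₂ wf.2 V V' hd hV w hw)
  | diaC a φ ih => intro wf V V' hd hV; exact h.dia _ (ih wf V V' hd hV)
  | diaNC a φ ih => intro wf V V' hd hV; exact h.dia _ (ih wf V V' hd hV)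
  | diaT φ ih => intro wf V V' hd hV; exact h.dia _ (ih wf V V' hd hV)
  | mu T φ ih =>
    intro wf V V' hd hV w hw
    have hdom : ∀ X ⊆ F.dom, ∀ Z, Function.update V T X Z ⊆ F.dom := by
      intro X hX Z
      by_cases hT : Z = T
      · subst hT; simpa using hX
      · simpa [Function.update_of_ne hT] using hd Z
    have key : ∀ X X', X ⊆ F.dom → (∀ w ∈ G, w ∈ X ↔ π w ∈ X') →
        ∀ w ∈ G, w ∈ F.sem φ (Function.update V T X) ↔
          π w ∈ F'.sem φ (Function.update V' T X') := by
      intro X X' hXd hX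
      refine ih wf.2 _ _ (hdom X hXd) fun Z => ?_
      by_cases hT : Z = T
      · subst hT; simpa using hX
      · simpa [Function.update_of_ne hT] using hV Z
    constructor
    · rintro hm P' ⟨-, hP'⟩
      -- The pullback of `P'`, enlarged by all points of the domain outside `G`, because `key` gives
      -- information on `G` only.
      have hmem : ({x | x ∈ F.dom ∧ (x ∈ G → π x ∈ P')} : Set W) ∈
          {Q | Q ⊆ F.dom ∧ F.sem φ (Function.update V T Q) ⊆ Q} := by
        refine ⟨fun x hx => hx.1, fun x hx => ⟨?_, fun hxG => hP' ?_⟩⟩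
        · exact sem_subset_dom h.rel_dom φ _ (hdom _ fun x hx => hx.1) hx
        · exact (key {x | x ∈ F.dom ∧ (x ∈ G → π x ∈ P')} P' (fun x hx => hx.1)
            (fun y hy => ⟨fun h => h.2 hy, fun h' => ⟨h.sub hy, fun _ => h'⟩⟩) x hxG).1 hx
      exact (hm _ hmem).2 hw
    · rintro hm P ⟨hPd, hP⟩
      -- `P` need not be a union of fibres of `π`. `X'` collects the points whose fibre in `G` lies
      -- in `P`, and `X` is the part of `P` that matches `X'` on `G`.
      set X' : Set W' := {q | ∀ x ∈ G, π x = q → x ∈ P} with hX'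
      set X : Set W := {x | x ∈ P ∧ (x ∈ G → π x ∈ X')} with hX
      have hXP : X ⊆ P := fun x hx => hx.1
      have hpre : F'.sem φ (Function.update V' T X') ⊆ X' := by
        rintro q hq x hx rfl
        -- Positivity of `T` enters here: the operator may be applied to the smaller set `X` instead
        -- of `P`.
        refine hP (sem_mono wf.1 V hXP ?_)
        exact (key X X' (hXP.trans hPd)
          (fun y hy => ⟨fun h => h.2 hy, fun h' => ⟨h' y hy rfl, fun _ => h'⟩⟩) x hx).2 hq
      exact hm X' ⟨by rw [h.total]; exact Set.subset_univ _, hpre⟩ w hw rfl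

end ModalFrame

/-! ### Unfolding of fixpoints -/

namespace TFL

variable {L : Type v}

/-- The substitution of `χ` for the variable `Z` in a formula without fixpoints. -/
def subst (Z : ℕ) (χ : TFL L) : TFL L → TFL L
  | var Y => if Y = Z then χ else var Y
  | neg φ => neg (subst Z χ φ)
  | and φ ψ => and (subst Z χ φ) (subst Z χ ψ)
  | diaC a φ => diaC a (subst Z χ φ)
  | diaNC a φ => diaNC a (subst Z χ φ)
  | diaT φ => diaT (subst Z χ φ)
  | mu Y φ => mu Y φ

/-- Formulae without fixpoints. -/
def FixFree : TFL L → Prop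
  | var _ => True
  | neg φ => FixFree φ
  | and φ ψ => FixFree φ ∧ FixFree ψ
  | diaC _ φ => FixFree φ
  | diaNC _ φ => FixFree φ
  | diaT φ => FixFree φ
  | mu _ _ => False

/-- A formula that denotes the empty set. -/
def bot : TFL L := and (var 0) (neg (var 0))

/-- The replacement of each least fixpoint by its `K`-th approximant. -/
def unfold (K : ℕ) : TFL L → TFL L
  | var Y => var Y
  | neg φ => neg (unfold K φ)
  | and φ ψ => and (unfold K φ) (unfold K ψ)
  | diaC a φ => diaC a (unfold K φ)
  | diaNC a φ => diaNC a (unfold K φ)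
  | diaT φ => diaT (unfold K φ)
  | mu Z φ => (fun χ => subst Z χ (unfold K φ))^[K] bot

theorem FixFree.subst {Z : ℕ} {χ : TFL L} (hχ : χ.FixFree) :
    ∀ φ : TFL L, φ.FixFree → (subst Z χ φ).FixFree
  | var Y, _ => by unfold TFL.subst; split_ifs <;> trivial
  | neg φ, h => FixFree.subst hχ φ h
  | and φ ψ, h => ⟨FixFree.subst hχ φ h.1, FixFree.subst hχ ψ h.2⟩
  | diaC _ φ, h => FixFree.subst hχ φ h
  | diaNC _ φ, h => FixFree.subst hχ φ h
  | diaT φ, h => FixFree.subst hχ φ h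

theorem fixFree_unfold (K : ℕ) : ∀ φ : TFL L, (unfold K φ).FixFree
  | var _ => trivial
  | neg φ => fixFree_unfold K φ
  | and φ ψ => ⟨fixFree_unfold K φ, fixFree_unfold K ψ⟩
  | diaC _ φ => fixFree_unfold K φ
  | diaNC _ φ => fixFree_unfold K φ
  | diaT φ => fixFree_unfold K φ
  | mu Z φ => by
    have : ∀ n, ((fun χ => TFL.subst Z χ (unfold K φ))^[n] bot).FixFree := by
      intro n
      induction n with
      | zero => exact ⟨trivial, trivial⟩
      | succ n ih =>
        rw [Function.iterate_succ_apply']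
        exact FixFree.subst ih _ (fixFree_unfold K φ)
    exact this K

end TFL

/-- On a finite type with at most `K` elements the least fixpoint of a monotone operator on sets
is its `K`-th iterate on the empty set. -/
theorem sInter_prefixpoints_eq_iterate {W : Type*} [Finite W] {f : Set W → Set W}
    (hf : Monotone f) {K : ℕ} (hK : Nat.card W ≤ K) : ⋂₀ {Q | f Q ⊆ Q} = f^[K] ∅ := by
  have hle : ∀ n, f^[n] ∅ ⊆ f^[n + 1] ∅ := by
    intro n
    induction n with
    | zero => exact Set.empty_subset _
    | succ n ih =>
      rw [Function.iterate_succ_apply', Function.iterate_succ_apply' f (n + 1)]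
      exact hf ih
  -- A chain that is not yet stationary at stage `n` has gained a point at every stage.
  have hcard : ∀ n, f (f^[n] ∅) = f^[n] ∅ ∨ n ≤ (f^[n] ∅).ncard := by
    intro n
    induction n with
    | zero => exact Or.inr (Nat.zero_le _)
    | succ n ih =>
      by_cases h : f^[n + 1] ∅ = f^[n] ∅
      · left
        rw [h, ← Function.iterate_succ_apply' f n, h]
      · right
        have h' : n ≤ (f^[n] ∅).ncard := by
          refine ih.resolve_left fun h' => h ?_
          rw [Function.iterate_succ_apply', h']
        have : (f^[n] ∅).ncard < (f^[n + 1] ∅).ncard :=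
          Set.ncard_lt_ncard ((hle n).ssubset_of_ne (Ne.symm h)) (Set.toFinite _)
        omega
  have hfix : f (f^[K] ∅) ⊆ f^[K] ∅ := by
    rcases hcard K with h | h
    · exact h.subset
    · have : f^[K] ∅ = Set.univ := by
        apply Set.eq_of_subset_of_ncard_le (Set.subset_univ _) _ (Set.toFinite _)
        rw [Set.ncard_univ]
        exact hK.trans h
      rw [this]
      exact Set.subset_univ _
  apply Set.Subset.antisymm (Set.sInter_subset_of_mem hfix)
  apply Set.subset_sInter
  intro Q hQ
  have : ∀ n, f^[n] ∅ ⊆ Q := by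
    intro n
    induction n with
    | zero => exact Set.empty_subset _
    | succ n ih =>
      rw [Function.iterate_succ_apply']
      exact (hf ih).trans hQ
  exact this K

namespace ModalFrame

variable {L : Type v} {W : Type*} {F : ModalFrame L W}

/-- A fixpoint-free formula binds nothing, so no variable of `χ` is captured, and the `mu` clause of
`TFL.subst`, which does not substitute, never applies. -/
theorem sem_subst (Z : ℕ) (χ : TFL L) (V : ℕ → Set W) : ∀ φ : TFL L, φ.FixFree →
    F.sem (TFL.subst Z χ φ) V = F.sem φ (Function.update V Z (F.sem χ V))
  | .var Y, _ => by
    by_cases h : Y = Z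
    · subst h; simp [TFL.subst, sem]
    · simp [TFL.subst, sem, h]
  | .neg φ, h => by simp only [TFL.subst, sem, sem_subst Z χ V φ h]
  | .and φ ψ, h => by simp only [TFL.subst, sem, sem_subst Z χ V φ h.1, sem_subst Z χ V ψ h.2]
  | .diaC _ φ, h => by simp only [TFL.subst, sem, sem_subst Z χ V φ h]
  | .diaNC _ φ, h => by simp only [TFL.subst, sem, sem_subst Z χ V φ h]
  | .diaT φ, h => by simp only [TFL.subst, sem, sem_subst Z χ V φ h]

/-- In a frame with at most `K` points the fixpoints may be replaced by their `K`-th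
approximants. -/
theorem sem_unfold [Finite W] (hF : F.dom = Set.univ) {K : ℕ} (hK : Nat.card W ≤ K) :
    ∀ φ : TFL L, φ.WellFormed → ∀ V : ℕ → Set W, F.sem (φ.unfold K) V = F.sem φ V
  | .var Y, _, V => rfl
  | .neg φ, h, V => by simp only [TFL.unfold, sem, sem_unfold hF hK φ h]
  | .and φ ψ, h, V => by
    simp only [TFL.unfold, sem, sem_unfold hF hK φ h.1, sem_unfold hF hK ψ h.2]
  | .diaC _ φ, h, V => by simp only [TFL.unfold, sem, sem_unfold hF hK φ h]
  | .diaNC _ φ, h, V => by simp only [TFL.unfold, sem, sem_unfold hF hK φ h]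
  | .diaT φ, h, V => by simp only [TFL.unfold, sem, sem_unfold hF hK φ h]
  | .mu Z φ, h, V => by
    -- Inner fixpoints are already unfolded in `φ.unfold K`, so one substitution amounts to one
    -- application of the operator defined by `φ`.
    have hn : ∀ n, F.sem ((fun χ => TFL.subst Z χ (φ.unfold K))^[n] TFL.bot) V =
        (fun X => F.sem φ (Function.update V Z X))^[n] ∅ := by
      intro n
      induction n with
      | zero => simp [TFL.bot, sem]
      | succ n ih =>
        rw [Function.iterate_succ_apply', Function.iterate_succ_apply',
          sem_subst _ _ _ _ (TFL.fixFree_unfold K φ), ih, sem_unfold hF hK φ h.2]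
    simp only [TFL.unfold, sem, hn, hF, Set.subset_univ, true_and]
    exact (sInter_prefixpoints_eq_iterate (sem_mono h.1 V) hK).symm

end ModalFrame

/-! ### Processes as points of a modal frame -/

namespace TSI

variable {S : Type u} {L : Type v} (𝔗 : TSI S L)

/-- The modal frame of the stateless maximal process space. -/
def frame : ModalFrame L (Proc S L) where
  dom := 𝔗.procSpace
  rel
    | some (true, a), H, H' => H ∈ 𝔗.procSpace ∧ ∃ r ∈ H.1, r.lab = a ∧ 𝔗.Causal H.2 r ∧
        H' = (𝔗.maxSet r.tgt, some r)
    | some (false, a), H, H' => H ∈ 𝔗.procSpace ∧ ∃ r ∈ H.1, r.lab = a ∧ 𝔗.LinConc H.2 r ∧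
        H' = (𝔗.maxSet r.tgt, some r)
    | none, H, H' => H ∈ 𝔗.procSpace ∧ ∃ M ∈ 𝔗.maximalSupports, 𝔗.CompleteTrace M H.1 ∧
        H' = (M, H.2)

/-- The chosen transition or trace determines the successor process, so the diamonds are those of a
frame. This makes the results on frames available for `denot`. -/
theorem sem_frame (φ : TFL L) : ∀ V, 𝔗.frame.sem φ V = 𝔗.denot φ V := by
  induction φ with
  | var T => exact fun V => rfl
  | neg φ ih => intro V; simp only [ModalFrame.sem, denot, ih]; rfl
  | and φ ψ ih₁ ih₂ => intro V; simp only [ModalFrame.sem, denot, ih₁, ih₂]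
  | diaC a φ ih =>
    intro V
    ext H
    rw [ModalFrame.sem, denot, ih]
    constructor
    · rintro ⟨_, ⟨h1, r, h2, h3, h4, rfl⟩, h5⟩; exact ⟨h1, r, h2, h3, h4, h5⟩
    · rintro ⟨h1, r, h2, h3, h4, h5⟩; exact ⟨_, ⟨h1, r, h2, h3, h4, rfl⟩, h5⟩
  | diaNC a φ ih =>
    intro V
    ext H
    rw [ModalFrame.sem, denot, ih]
    constructor
    · rintro ⟨_, ⟨h1, r, h2, h3, h4, rfl⟩, h5⟩; exact ⟨h1, r, h2, h3, h4, h5⟩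
    · rintro ⟨h1, r, h2, h3, h4, h5⟩; exact ⟨_, ⟨h1, r, h2, h3, h4, rfl⟩, h5⟩
  | diaT φ ih =>
    intro V
    ext H
    rw [ModalFrame.sem, denot, ih]
    constructor
    · rintro ⟨_, ⟨h1, M, h2, h3, rfl⟩, h5⟩; exact ⟨h1, M, h2, h3, h5⟩
    · rintro ⟨h1, M, h2, h3, h5⟩; exact ⟨_, ⟨h1, M, h2, h3, rfl⟩, h5⟩
  | mu T φ ih => intro V; simp only [ModalFrame.sem, denot, ih]; rfl

end TSI

/-! ### Isomorphisms of futures -/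

namespace EventStructure

variable {E : Type u} {L : Type v} (𝓔 : EventStructure E L)

/-- The relation `ρ` is (the graph of) an isomorphism between the futures of `C` and `D`. -/
structure FutIso (C D : Set E) (ρ : E → E → Prop) : Prop where
  left : ∀ {x y}, ρ x y → x ∈ 𝓔.future C
  right : ∀ {x y}, ρ x y → y ∈ 𝓔.future D
  total : ∀ {x}, x ∈ 𝓔.future C → ∃ y, ρ x y
  surj : ∀ {y}, y ∈ 𝓔.future D → ∃ x, ρ x y
  le_iff : ∀ {x y x' y'}, ρ x y → ρ x' y' → (𝓔.le x x' ↔ 𝓔.le y y')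
  conflict_iff : ∀ {x y x' y'}, ρ x y → ρ x' y' → (𝓔.conflict x x' ↔ 𝓔.conflict y y')
  lab_eq : ∀ {x y}, ρ x y → 𝓔.lab y = 𝓔.lab x

variable {𝓔}

theorem FutIso.refl (C : Set E) : 𝓔.FutIso C C fun x y => x = y ∧ x ∈ 𝓔.future C where
  left h := h.2
  right h := h.1 ▸ h.2
  total h := ⟨_, rfl, h⟩
  surj h := ⟨_, rfl, h⟩
  le_iff h h' := by rw [h.1, h'.1]
  conflict_iff h h' := by rw [h.1, h'.1]
  lab_eq h := by rw [h.1]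

theorem FutIso.symm {C D : Set E} {ρ : E → E → Prop} (h : 𝓔.FutIso C D ρ) :
    𝓔.FutIso D C fun x y => ρ y x where
  left := h.right
  right := h.left
  total := h.surj
  surj := h.total
  le_iff h1 h2 := (h.le_iff h1 h2).symm
  conflict_iff h1 h2 := (h.conflict_iff h1 h2).symm
  lab_eq h1 := (h.lab_eq h1).symm

theorem FutIso.trans {B C D : Set E} {ρ σ : E → E → Prop} (h : 𝓔.FutIso B C ρ)
    (h' : 𝓔.FutIso C D σ) : 𝓔.FutIso B D fun x z => ∃ y, ρ x y ∧ σ y z where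
  left := fun ⟨_, h1, _⟩ => h.left h1
  right := fun ⟨_, _, h2⟩ => h'.right h2
  total hx := by
    obtain ⟨y, hy⟩ := h.total hx
    obtain ⟨z, hz⟩ := h'.total (h.right hy)
    exact ⟨z, y, hy, hz⟩
  surj hz := by
    obtain ⟨y, hy⟩ := h'.surj hz
    obtain ⟨x, hx⟩ := h.surj (h'.left hy)
    exact ⟨x, y, hx, hy⟩
  le_iff := fun ⟨_, h1, h2⟩ ⟨_, h3, h4⟩ => (h.le_iff h1 h3).trans (h'.le_iff h2 h4)
  conflict_iff := fun ⟨_, h1, h2⟩ ⟨_, h3, h4⟩ =>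
    (h.conflict_iff h1 h3).trans (h'.conflict_iff h2 h4)
  lab_eq := fun ⟨_, h1, h2⟩ => (h'.lab_eq h2).trans (h.lab_eq h1)

/-- The graph of the bijection is a relation on all events, so that isomorphisms can be composed and
restricted without subtypes. -/
theorem SameFuture.exists_futIso {C D : Set E} (h : 𝓔.SameFuture C D) :
    ∃ ρ, 𝓔.FutIso C D ρ := by
  obtain ⟨f, hf⟩ := h
  refine ⟨fun x y => ∃ hx : x ∈ 𝓔.future C, (f ⟨x, hx⟩ : E) = y, ?_⟩
  exact
    { left := fun ⟨hx, _⟩ => hx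
      right := by rintro x _ ⟨hx, rfl⟩; exact (f ⟨x, hx⟩).2
      total := fun hx => ⟨_, hx, rfl⟩
      surj := fun {y} hy => ⟨f.symm ⟨y, hy⟩, (f.symm ⟨y, hy⟩).2, by simp⟩
      le_iff := by rintro x _ x' _ ⟨hx, rfl⟩ ⟨hx', rfl⟩; exact (hf ⟨x, hx⟩ ⟨x', hx'⟩).1
      conflict_iff := by
        rintro x _ x' _ ⟨hx, rfl⟩ ⟨hx', rfl⟩; exact (hf ⟨x, hx⟩ ⟨x', hx'⟩).2.1
      lab_eq := by rintro x _ ⟨hx, rfl⟩; exact (hf ⟨x, hx⟩ ⟨x, hx⟩).2.2 }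

/-- Reflexivity at `x` gives `y ≼ y'` and `y' ≼ y`. Because of antisymmetry, `FutIso` needs no field
for uniqueness. -/
theorem FutIso.right_unique {C D : Set E} {ρ : E → E → Prop} (h : 𝓔.FutIso C D ρ) {x y y' : E}
    (h1 : ρ x y) (h2 : ρ x y') : y = y' :=
  𝓔.le_antisymm ((h.le_iff h1 h2).1 (𝓔.le_refl x)) ((h.le_iff h2 h1).1 (𝓔.le_refl x))

theorem FutIso.left_unique {C D : Set E} {ρ : E → E → Prop} (h : 𝓔.FutIso C D ρ) {x x' y : E}
    (h1 : ρ x y) (h2 : ρ x' y) : x = x' :=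
  h.symm.right_unique h1 h2

variable (𝓔) in
theorem Conf.isConf (C : 𝓔.Conf) : 𝓔.IsConf C.1 := by
  obtain ⟨C, hC⟩ := C
  cases hC with
  | refl => exact ⟨fun _ h => h.elim, fun _ h => h.elim⟩
  | tail _ h => obtain ⟨e, he⟩ := h; exact he.2.1

theorem mem_enabled_iff {C : Set E} {e : E} : e ∈ 𝓔.enabled C ↔ 𝓔.Step C e (insert e C) := by
  constructor
  · rintro ⟨C', h⟩
    obtain rfl := h.2.2.2
    exact h
  · exact fun h => ⟨_, h⟩

/-- The enabled events are the minimal elements of the future. -/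
theorem mem_enabled_iff_minimal {C : Set E} (hC : 𝓔.IsConf C) {e : E} :
    e ∈ 𝓔.enabled C ↔ e ∈ 𝓔.future C ∧ ∀ e' ∈ 𝓔.future C, 𝓔.le e' e → e' = e := by
  rw [mem_enabled_iff]
  constructor
  · rintro ⟨-, h2, h3, -⟩
    refine ⟨⟨h3, fun c hc => h2.1 c (Or.inr hc) e (Or.inl rfl)⟩, fun e' he' hle => ?_⟩
    exact (h2.2 e (Or.inl rfl) e' hle).resolve_right he'.1
  · rintro ⟨h1, h2⟩
    refine ⟨hC, ⟨?_, ?_⟩, h1.1, rfl⟩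
    · rintro x (rfl | hx) y (rfl | hy)
      · exact 𝓔.conflict_irrefl _
      · exact fun h => h1.2 y hy (𝓔.conflict_symm h)
      · exact h1.2 x hx
      · exact hC.1 x hx y hy
    · rintro x (rfl | hx) y hy
      · by_cases hyC : y ∈ C
        · exact Or.inr hyC
        -- A cause of the new event outside `C` lies in the future, since a conflict with `C` would
        -- be inherited by the new event; minimality applies.
        · exact Or.inl (h2 y ⟨hyC, fun c hc h => h1.2 c hc (𝓔.conflict_inherit h hy)⟩ hy)
      · exact Or.inr (hC.2 x hx y hy)

/-- Enabled means minimal in the future, a property invariant under order isomorphisms. -/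
theorem FutIso.enabled_iff {C D : Set E} {ρ : E → E → Prop} (h : 𝓔.FutIso C D ρ)
    (hC : 𝓔.IsConf C) (hD : 𝓔.IsConf D) {x y : E} (hxy : ρ x y) :
    x ∈ 𝓔.enabled C ↔ y ∈ 𝓔.enabled D := by
  rw [mem_enabled_iff_minimal hC, mem_enabled_iff_minimal hD]
  constructor
  · rintro ⟨-, h2⟩
    refine ⟨h.right hxy, fun y' hy' hle => ?_⟩
    obtain ⟨x', hx'⟩ := h.surj hy'
    obtain rfl := h2 x' (h.left hx') ((h.le_iff hx' hxy).2 hle)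
    exact h.right_unique hx' hxy
  · rintro ⟨-, h2⟩
    refine ⟨h.left hxy, fun x' hx' hle => ?_⟩
    obtain ⟨y', hy'⟩ := h.total hx'
    obtain rfl := h2 y' (h.right hy') ((h.le_iff hy' hxy).1 hle)
    exact h.left_unique hy' hxy

theorem mem_future_insert {C : Set E} {e x : E} :
    x ∈ 𝓔.future (insert e C) ↔ x ∈ 𝓔.future C ∧ x ≠ e ∧ ¬ 𝓔.conflict e x := by
  simp only [future, Set.mem_ofPred_eq, Set.mem_insert_iff, forall_eq_or_imp, not_or]
  tauto

/-- An isomorphism of futures restricts to the futures after corresponding events. -/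
theorem FutIso.insert {C D : Set E} {ρ : E → E → Prop} (h : 𝓔.FutIso C D ρ) {e e' : E}
    (he : ρ e e') :
    𝓔.FutIso (insert e C) (insert e' D)
      fun x y => ρ x y ∧ x ∈ 𝓔.future (Insert.insert e C) := by
  have key : ∀ {x y}, ρ x y →
      (x ∈ 𝓔.future (Insert.insert e C) ↔ y ∈ 𝓔.future (Insert.insert e' D)) := by
    intro x y hxy
    rw [mem_future_insert, mem_future_insert, h.conflict_iff he hxy]
    have : x = e ↔ y = e' :=
      ⟨fun hx => h.right_unique (hx ▸ hxy) he, fun hy => h.left_unique (hy ▸ hxy) he⟩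
    simp only [h.left hxy, h.right hxy, ne_eq, this]
  exact
    { left := fun h1 => h1.2
      right := fun h1 => (key h1.1).1 h1.2
      total := fun hx => by
        obtain ⟨y, hy⟩ := h.total (mem_future_insert.1 hx).1
        exact ⟨y, hy, hx⟩
      surj := fun hy => by
        obtain ⟨x, hx⟩ := h.surj (mem_future_insert.1 hy).1
        exact ⟨x, hx, (key hx).2 hy⟩
      le_iff := fun h1 h2 => h.le_iff h1.1 h2.1
      conflict_iff := fun h1 h2 => h.conflict_iff h1.1 h2.1
      lab_eq := fun h1 => h.lab_eq h1.1 }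

theorem enabled_subset_future {C : Set E} : 𝓔.enabled C ⊆ 𝓔.future C := fun _ h =>
  ((mem_enabled_iff_minimal (mem_enabled_iff.1 h).1).1 h).1

/-! ### Concurrency of enabled events -/

/-- Enabled events are minimal in the future, so distinct ones are incomparable and only conflict
can prevent concurrency. -/
theorem co_iff_of_enabled {C : Set E} {e f : E} (he : e ∈ 𝓔.enabled C) (hf : f ∈ 𝓔.enabled C) :
    𝓔.Co e f ↔ e ≠ f ∧ ¬ 𝓔.conflict e f := by
  have aux : ∀ {e f}, e ∈ 𝓔.enabled C → f ∈ 𝓔.enabled C → 𝓔.le e f → e = f := by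
    intro e f he hf hle
    rw [mem_enabled_iff_minimal (mem_enabled_iff.1 hf).1] at hf
    exact hf.2 e (enabled_subset_future he) hle
  constructor
  · exact fun h => ⟨h.ne, h.2.2⟩
  · rintro ⟨h1, h2⟩
    exact ⟨fun h => h1 (aux he hf h), fun h => h1 (aux hf he h).symm, h2⟩

/-- If `f` is already enabled at `C`, it is concurrent with `e` because both occur in the
configuration `C₂`; the converse is `step_back`. Independence of consecutive transitions thus
becomes a matter of enabledness, and this is what `Node.free` records. -/
theorem co_iff_of_steps {C C₁ C₂ : Set E} {e f : E} (he : 𝓔.Step C e C₁)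
    (hf : 𝓔.Step C₁ f C₂) : 𝓔.Co e f ↔ f ∈ 𝓔.enabled C := by
  constructor
  · exact fun h => ⟨_, 𝓔.step_back he hf h⟩
  · intro h
    have heC₂ : e ∈ C₂ := by rw [hf.2.2.2, he.2.2.2]; exact Or.inr (Or.inl rfl)
    have hfC₂ : f ∈ C₂ := by rw [hf.2.2.2]; exact Or.inl rfl
    refine (co_iff_of_enabled ⟨_, he⟩ h).2 ⟨?_, hf.2.1.1 e heC₂ f hfC₂⟩
    rintro rfl
    exact hf.2.2.1 (by rw [he.2.2.2]; exact Or.inl rfl)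

/-- After `e`, the event `f` stays enabled iff it is not in conflict with `e`. -/
theorem mem_enabled_insert_iff {C : Set E} {e f : E} (he : e ∈ 𝓔.enabled C)
    (hf : f ∈ 𝓔.enabled C) : f ∈ 𝓔.enabled (insert e C) ↔ e ≠ f ∧ ¬ 𝓔.conflict e f := by
  rw [← co_iff_of_enabled he hf]
  constructor
  · exact fun h => (co_iff_of_steps (mem_enabled_iff.1 he) (mem_enabled_iff.1 h)).2 hf
  · exact fun h => ⟨_, 𝓔.step_diamond (mem_enabled_iff.1 he) (mem_enabled_iff.1 hf) h⟩

/-- Source and target determine the event of a transition, so the witnesses in `tsiI` are unique. -/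
theorem tsiI_iff {t r : LTrans 𝓔.Conf L} {e f : E} (ht : t.lab = 𝓔.lab e)
    (hr : r.lab = 𝓔.lab f) (he : 𝓔.Step t.src.1 e t.tgt.1) (hf : 𝓔.Step r.src.1 f r.tgt.1) :
    𝓔.tsiI t r ↔ 𝓔.Co e f := by
  constructor
  · rintro ⟨e', f', h, -, -, h1, h2⟩
    rwa [he.unique h1, hf.unique h2]
  · exact fun h => ⟨e, f, h, ht, hr, he, hf⟩

/-! ### Nodes -/

variable (𝓔) in
/-- What matters for the truth of formulae in a process `(R, t)`: the target of `t`, the events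
enabled at the source of `t`, and the events of `R`. -/
structure Node where
  /-- the configuration -/
  conf : 𝓔.Conf
  /-- the events that are independent of the last one -/
  free : Set E
  /-- the events of the support set -/
  sup : Set E

/-- The configuration reached by an enabled event. -/
def Conf.next (C : 𝓔.Conf) (e : E) (he : e ∈ 𝓔.enabled C.1) : 𝓔.Conf :=
  ⟨insert e C.1, (mem_enabled_iff.1 he).conf C.2⟩

variable (𝓔) in
/-- `M` is a maximal conflict-free set of enabled events among those in `R`. -/
def MaxTrace (C M R : Set E) : Prop :=
  M ⊆ R ∩ 𝓔.enabled C ∧ (∀ e ∈ M, ∀ f ∈ M, ¬ 𝓔.conflict e f) ∧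
    ∀ e ∈ R ∩ 𝓔.enabled C, e ∉ M → ∃ f ∈ M, 𝓔.conflict e f

variable (𝓔) in
/-- The modal frame of nodes. -/
def nodeFrame : ModalFrame L 𝓔.Node where
  dom := Set.univ
  rel
    | some (b, a), ν, ν' => ∃ e ∈ ν.sup, 𝓔.Step ν.conf.1 e ν'.conf.1 ∧ 𝓔.lab e = a ∧
        (e ∈ ν.free ↔ b = false) ∧ ν'.free = 𝓔.enabled ν.conf.1 ∧
        ν'.sup = 𝓔.enabled ν'.conf.1
    | none, ν, ν' => ν'.conf = ν.conf ∧ ν'.free = ν.free ∧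
        𝓔.MaxTrace ν.conf.1 ν'.sup ν.sup

/-- Nodes are equivalent if the futures of their configurations are isomorphic by an isomorphism
that respects the two sets of events. -/
def Node.Equiv (ν μ : 𝓔.Node) : Prop :=
  ∃ ρ, 𝓔.FutIso ν.conf.1 μ.conf.1 ρ ∧ ∀ x y, ρ x y → x ∈ 𝓔.enabled ν.conf.1 →
    (x ∈ ν.free ↔ y ∈ μ.free) ∧ (x ∈ ν.sup ↔ y ∈ μ.sup)

variable (𝓔) in
/-- The setoid of equivalent nodes. -/
def nodeSetoid : Setoid 𝓔.Node where
  r := Node.Equiv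
  iseqv :=
    { refl := fun ν => ⟨_, FutIso.refl _, by rintro x y ⟨rfl, -⟩ _; exact ⟨Iff.rfl, Iff.rfl⟩⟩
      symm := by
        rintro ν μ ⟨ρ, h1, h2⟩
        refine ⟨_, h1.symm, fun x y hxy hx => ?_⟩
        obtain ⟨h3, h4⟩ := h2 y x hxy ((h1.enabled_iff ν.conf.isConf μ.conf.isConf hxy).2 hx)
        exact ⟨h3.symm, h4.symm⟩
      trans := by
        rintro ν μ κ ⟨ρ, h1, h2⟩ ⟨σ, h3, h4⟩
        refine ⟨_, h1.trans h3, ?_⟩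
        rintro x z ⟨y, hxy, hyz⟩ hx
        obtain ⟨h5, h6⟩ := h2 x y hxy hx
        obtain ⟨h7, h8⟩ := h4 y z hyz
          ((h1.enabled_iff ν.conf.isConf μ.conf.isConf hxy).1 hx)
        exact ⟨h5.trans h7, h6.trans h8⟩ }

/-- Equivalence of nodes is a bisimulation. -/
theorem Node.Equiv.bisim {ν μ ν' : 𝓔.Node} (h : ν.Equiv μ) {m : Option (Bool × L)}
    (hr : 𝓔.nodeFrame.rel m ν ν') : ∃ μ', 𝓔.nodeFrame.rel m μ μ' ∧ ν'.Equiv μ' := by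
  obtain ⟨ρ, h1, h2⟩ := h
  have hen := fun {x y} => h1.enabled_iff (x := x) (y := y) ν.conf.isConf μ.conf.isConf
  match m, hr with
  | some (b, a), hr =>
    obtain ⟨e, he, hs, hl, hb, hfree, hsup⟩ := hr
    have hee : e ∈ 𝓔.enabled ν.conf.1 := ⟨_, hs⟩
    obtain ⟨e', hρ⟩ := h1.total (enabled_subset_future hee)
    have hee' := (hen hρ).1 hee
    obtain ⟨h3, h4⟩ := h2 e e' hρ hee
    -- The matching move executes the image of `e`; the other two components of its target are
    -- forced.
    refine ⟨⟨μ.conf.next e' hee', 𝓔.enabled μ.conf.1, 𝓔.enabled (μ.conf.next e' hee').1⟩,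
      ⟨e', h4.1 he, mem_enabled_iff.1 hee', (h1.lab_eq hρ).trans hl, h3.symm.trans hb, rfl, rfl⟩,
      ?_⟩
    have h5 : 𝓔.FutIso ν'.conf.1 (μ.conf.next e' hee').1 _ := hs.2.2.2 ▸ h1.insert hρ
    refine ⟨_, h5, fun x y hxy hx => ⟨?_, ?_⟩⟩
    · rw [hfree]; exact hen hxy.1
    · rw [hsup]; exact h5.enabled_iff ν'.conf.isConf (Conf.isConf _ _) hxy
  | none, hr =>
    obtain ⟨hc, hf, hM, hcf, hmax⟩ := hr
    -- The matching trace is the image of the given one. Maximality carries over because each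
    -- enabled event on the right has an enabled preimage.
    refine ⟨⟨μ.conf, μ.free, {y | ∃ x ∈ ν'.sup, ρ x y}⟩, ⟨rfl, rfl, ?_, ?_, ?_⟩, ?_⟩
    · rintro y ⟨x, hx, hxy⟩
      exact ⟨(h2 x y hxy (hM hx).2).2.1 (hM hx).1, (hen hxy).1 (hM hx).2⟩
    · rintro y ⟨x, hx, hxy⟩ y' ⟨x', hx', hxy'⟩
      rw [← h1.conflict_iff hxy hxy']
      exact hcf x hx x' hx'
    · rintro y ⟨hyR, hye⟩ hyM
      obtain ⟨x, hxy⟩ := h1.surj (enabled_subset_future hye)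
      have hxe := (hen hxy).2 hye
      obtain ⟨x', hx', hxx'⟩ := hmax x ⟨(h2 x y hxy hxe).2.2 hyR, hxe⟩
        fun hx => hyM ⟨x, hx, hxy⟩
      obtain ⟨y', hxy'⟩ := h1.total (enabled_subset_future (hM hx').2)
      exact ⟨y', ⟨x', hx', hxy'⟩, (h1.conflict_iff hxy hxy').1 hxx'⟩
    · refine ⟨ρ, by rw [hc]; exact h1, fun x y hxy hx => ⟨?_, ?_⟩⟩
      · rw [hf]; exact (h2 x y hxy (hc ▸ hx)).1
      · exact ⟨fun h => ⟨x, h, hxy⟩, fun ⟨x', h, hxy'⟩ => h1.left_unique hxy hxy' ▸ h⟩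

variable (𝓔) in
/-- Equivalence classes of nodes. -/
abbrev NodeClass := Quotient 𝓔.nodeSetoid

/-- The class of a node. -/
def Node.cls (ν : 𝓔.Node) : 𝓔.NodeClass := Quotient.mk 𝓔.nodeSetoid ν

theorem Node.cls_eq {ν μ : 𝓔.Node} : ν.cls = μ.cls ↔ ν.Equiv μ := Quotient.eq (r := 𝓔.nodeSetoid)

variable (𝓔) in
/-- The quotient of the frame of nodes. -/
def classFrame : ModalFrame L 𝓔.NodeClass where
  dom := Set.univ
  rel m q q' := ∃ ν ν' : 𝓔.Node, ν.cls = q ∧ ν'.cls = q' ∧ 𝓔.nodeFrame.rel m ν ν'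

/-- By the bisimulation property, the moves of a class can be read off any of its representatives.
-/
theorem classFrame_rel_iff {m : Option (Bool × L)} {ν : 𝓔.Node} {q : 𝓔.NodeClass} :
    𝓔.classFrame.rel m ν.cls q ↔ ∃ ν', 𝓔.nodeFrame.rel m ν ν' ∧ ν'.cls = q := by
  constructor
  · rintro ⟨μ, μ', h1, rfl, h2⟩
    obtain ⟨ν', h3, h4⟩ := (Node.cls_eq.1 h1).bisim h2
    exact ⟨ν', h3, (Node.cls_eq.2 h4).symm⟩
  · rintro ⟨ν', h1, h2⟩
    exact ⟨ν, ν', rfl, h2, h1⟩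

/-! ### From processes to nodes -/

variable (𝓔) in
/-- The target of a transition; the initial configuration for the empty transition. -/
def target : Option (LTrans 𝓔.Conf L) → 𝓔.Conf
  | none => 𝓔.initConf
  | some t => t.tgt

variable (𝓔) in
/-- The events enabled at the source of a transition; none for the empty transition. -/
def freeEvents : Option (LTrans 𝓔.Conf L) → Set E
  | none => ∅
  | some t => 𝓔.enabled t.src.1

variable (𝓔) in
/-- The events of a set of transitions. -/
def events (P : Set (LTrans 𝓔.Conf L)) : Set E := {e | ∃ r ∈ P, 𝓔.Step r.src.1 e r.tgt.1}

variable (𝓔) in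
/-- The node of a process. -/
def nodeOf (H : TSI.Proc 𝓔.Conf L) : 𝓔.Node :=
  ⟨𝓔.target H.2, 𝓔.freeEvents H.2, 𝓔.events H.1⟩

variable (𝓔) in
/-- Processes whose support set is located at the target of the last transition. -/
def localProcs : Set (TSI.Proc 𝓔.Conf L) :=
  {H | H ∈ 𝓔.toTSI.procSpace ∧ H.1 ⊆ 𝓔.toTSI.maxSet (𝓔.target H.2)}

/-- The transitions are consecutive, so `co_iff_of_steps` applies. For the empty transition
`freeEvents` is empty, which makes every initial transition causal. -/
theorem causal_iff {o : Option (LTrans 𝓔.Conf L)} (ho : 𝓔.toTSI.IsAct o)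
    {r : LTrans 𝓔.Conf L} (hr : r ∈ 𝓔.tsiT) (hsrc : r.src = 𝓔.target o) {e : E}
    (he : 𝓔.Step r.src.1 e r.tgt.1) :
    (𝓔.toTSI.Causal o r ↔ e ∉ 𝓔.freeEvents o) ∧ (𝓔.toTSI.LinConc o r ↔ e ∈ 𝓔.freeEvents o) := by
  cases o with
  | none =>
    exact ⟨⟨fun _ => id, fun _ => ⟨hr, hsrc⟩⟩, ⟨fun h => h.elim, fun h => h.elim⟩⟩
  | some t =>
    have ht : t ∈ 𝓔.tsiT := ho
    obtain ⟨f, hf, hfs⟩ := ht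
    obtain ⟨e', hl, he'⟩ := hr
    obtain rfl := he.unique he'
    have hI : 𝓔.tsiI t r ↔ e ∈ 𝓔.enabled t.src.1 := by
      rw [tsiI_iff hf hl hfs he]
      have h2 : 𝓔.Step t.tgt.1 e r.tgt.1 := by
        have : r.src = t.tgt := hsrc
        rw [← this]; exact he
      exact co_iff_of_steps hfs h2
    exact ⟨⟨fun h => fun h' => h.2.2.2 (hI.2 h'),
        fun h => ⟨ho, ⟨e, hl, he⟩, hsrc.symm, fun h' => h (hI.1 h')⟩⟩,
      ⟨fun h => hI.1 h.2.2.2, fun h => ⟨ho, ⟨e, hl, he⟩, hsrc.symm, hI.2 h⟩⟩⟩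

/-- The transition from `C` by an enabled event. -/
def trans (C : 𝓔.Conf) (e : E) (he : e ∈ 𝓔.enabled C.1) : LTrans 𝓔.Conf L :=
  (C, 𝓔.lab e, C.next e he)

theorem trans_mem {C : 𝓔.Conf} {e : E} (he : e ∈ 𝓔.enabled C.1) :
    trans C e he ∈ 𝓔.toTSI.maxSet C :=
  ⟨⟨e, rfl, mem_enabled_iff.1 he⟩, rfl⟩

/-- A transition is determined by its source and its event. -/
theorem eq_trans {C : 𝓔.Conf} {r : LTrans 𝓔.Conf L} (hr : r ∈ 𝓔.toTSI.maxSet C) {e : E}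
    (he : 𝓔.Step r.src.1 e r.tgt.1) :
    ∃ h : e ∈ 𝓔.enabled C.1, r = trans C e h := by
  obtain ⟨s, a, s'⟩ := r
  obtain ⟨⟨e', hl, he'⟩, hs⟩ := hr
  obtain rfl := he.unique he'
  simp only [LTrans.src, LTrans.lab, LTrans.tgt] at *
  subst hs
  subst hl
  exact ⟨⟨_, he⟩, congrArg (fun x => (s, 𝓔.lab e, x)) (Subtype.ext he.2.2.2)⟩

/-- With a common source, events and transitions correspond bijectively, so `events` loses no
information. -/
theorem mem_events_iff {C : 𝓔.Conf} {P : Set (LTrans 𝓔.Conf L)} (hP : P ⊆ 𝓔.toTSI.maxSet C)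
    {e : E} : e ∈ 𝓔.events P ↔ ∃ h : e ∈ 𝓔.enabled C.1, trans C e h ∈ P := by
  constructor
  · rintro ⟨r, hr, he⟩
    obtain ⟨h, rfl⟩ := eq_trans (hP hr) he
    exact ⟨h, hr⟩
  · rintro ⟨h, hm⟩
    exact ⟨_, hm, mem_enabled_iff.1 h⟩

theorem events_maxSet (C : 𝓔.Conf) : 𝓔.events (𝓔.toTSI.maxSet C) = 𝓔.enabled C.1 := by
  ext e
  rw [mem_events_iff subset_rfl]
  exact ⟨fun ⟨h, _⟩ => h, fun h => ⟨h, trans_mem h⟩⟩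

theorem immConc_trans_iff {C : 𝓔.Conf} {e f : E} (he : e ∈ 𝓔.enabled C.1)
    (hf : f ∈ 𝓔.enabled C.1) :
    𝓔.toTSI.ImmConc (trans C e he) (trans C f hf) ↔ e ≠ f ∧ ¬ 𝓔.conflict e f := by
  rw [← co_iff_of_enabled he hf, ← tsiI_iff (t := trans C e he) (r := trans C f hf) rfl rfl
    (mem_enabled_iff.1 he) (mem_enabled_iff.1 hf)]
  exact ⟨fun h => h.2.2.2, fun h => ⟨(trans_mem he).1, (trans_mem hf).1, rfl, h⟩⟩

end EventStructure

/-- The conditions of being a support set and of belonging to `𝒳` are automatic. A non-empty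
conflict-free `M` is a support set, and an empty `M` forces `R` to be empty, because any element of
`R` would extend it. -/
theorem TSI.completeTrace_iff {S : Type u} {L : Type v} (𝔗 : TSI S L) {M R : Set (LTrans S L)}
    {s : S} (hR : R ∈ 𝔗.maximalSupports) (hs : R ⊆ 𝔗.maxSet s) :
    M ∈ 𝔗.maximalSupports ∧ 𝔗.CompleteTrace M R ↔
      M ⊆ R ∧ (∀ t ∈ M, ∀ t' ∈ M, t ≠ t' → 𝔗.ImmConc t t') ∧
        ∀ t ∈ R, t ∉ M → ∃ t' ∈ M, ¬ 𝔗.ImmConc t t' := by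
  constructor
  · rintro ⟨-, -, h1, h2, h3⟩
    refine ⟨h2, h1.2, fun t ht htM => ?_⟩
    by_contra! h
    exact h3 ⟨t, ⟨ht, htM⟩, h⟩
  · rintro ⟨h1, h2, h3⟩
    have hneg : ¬ ∃ t ∈ R \ M, ∀ t' ∈ M, 𝔗.ImmConc t t' := by
      rintro ⟨t, ht, h⟩
      obtain ⟨t', ht', h'⟩ := h3 t ht.1 ht.2
      exact h' (h t' ht')
    have hcf : 𝔗.ConflictFree M := ⟨⟨s, h1.trans hs⟩, h2⟩
    have hsup : 𝔗.IsSupport M := by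
      rcases M.eq_empty_or_nonempty with rfl | hM
      · have : R = ∅ := by
          by_contra h
          obtain ⟨t, ht⟩ := Set.nonempty_iff_ne_empty.2 h
          obtain ⟨t', ht', -⟩ := h3 t ht id
          exact ht'
        subst this
        obtain ⟨s', h | h⟩ := hR
        · exact Or.inl ⟨s', h⟩
        · exact h.1
      · exact Or.inr ⟨hM, hcf⟩
    refine ⟨?_, hsup, hcf, h1, hneg⟩
    obtain ⟨s', rfl | h⟩ := hR
    · exact ⟨s', Or.inr ⟨hsup, hcf, h1, hneg⟩⟩
    -- Here `R` is itself conflict-free, so its only complete trace is `R`.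
    · have : M = R := by
        refine Set.Subset.antisymm h1 fun t ht => ?_
        by_contra htM
        obtain ⟨t', ht', h'⟩ := h3 t ht htM
        exact h' (h.2.1.2 t ht t' (h1 ht') fun h => htM (h ▸ ht'))
      rw [this]
      exact ⟨s', Or.inr h⟩

namespace EventStructure

variable {E : Type u} {L : Type v} {𝓔 : EventStructure E L}

/-- Among transitions from `C`, immediate concurrency means distinct events without conflict, so
maximal traces match on both sides. -/
theorem maxTrace_events_iff {C : 𝓔.Conf} {M R : Set (LTrans 𝓔.Conf L)}
    (hR : R ⊆ 𝓔.toTSI.maxSet C) (hM : M ⊆ 𝓔.toTSI.maxSet C) :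
    𝓔.MaxTrace C.1 (𝓔.events M) (𝓔.events R) ↔
      M ⊆ R ∧ (∀ t ∈ M, ∀ t' ∈ M, t ≠ t' → 𝓔.toTSI.ImmConc t t') ∧
        ∀ t ∈ R, t ∉ M → ∃ t' ∈ M, ¬ 𝓔.toTSI.ImmConc t t' := by
  have hev : ∀ r ∈ 𝓔.toTSI.maxSet C, ∃ e, ∃ h : e ∈ 𝓔.enabled C.1, r = trans C e h := by
    rintro r hr
    obtain ⟨e, -, he⟩ := hr.1
    exact ⟨e, eq_trans hr he⟩
  constructor
  · rintro ⟨h1, h2, h3⟩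
    refine ⟨?_, ?_, ?_⟩
    · intro r hr
      obtain ⟨e, he, rfl⟩ := hev r (hM hr)
      obtain ⟨_, h⟩ := (mem_events_iff hR).1 (h1 ((mem_events_iff hM).2 ⟨he, hr⟩)).1
      exact h
    · intro t ht t' ht' hne
      obtain ⟨e, he, rfl⟩ := hev t (hM ht)
      obtain ⟨f, hf, rfl⟩ := hev t' (hM ht')
      refine (immConc_trans_iff he hf).2 ⟨?_, h2 e ((mem_events_iff hM).2 ⟨he, ht⟩) f
        ((mem_events_iff hM).2 ⟨hf, ht'⟩)⟩
      rintro rfl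
      exact hne rfl
    · intro t ht htM
      obtain ⟨e, he, rfl⟩ := hev t (hR ht)
      obtain ⟨f, hf, hc⟩ := h3 e ⟨(mem_events_iff hR).2 ⟨he, ht⟩, he⟩
        fun h => htM ((mem_events_iff hM).1 h).2
      obtain ⟨hf', hfM⟩ := (mem_events_iff hM).1 hf
      exact ⟨_, hfM, fun h => ((immConc_trans_iff he hf').1 h).2 hc⟩
  · rintro ⟨h1, h2, h3⟩
    refine ⟨?_, ?_, ?_⟩
    · intro e he
      obtain ⟨he', hm⟩ := (mem_events_iff hM).1 he
      exact ⟨(mem_events_iff hR).2 ⟨he', h1 hm⟩, he'⟩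
    · intro e he f hf
      obtain ⟨he', hme⟩ := (mem_events_iff hM).1 he
      obtain ⟨hf', hmf⟩ := (mem_events_iff hM).1 hf
      by_cases hef : e = f
      · subst hef; exact 𝓔.conflict_irrefl e
      · refine ((immConc_trans_iff he' hf').1 (h2 _ hme _ hmf fun h => hef ?_)).2
        have h4 : 𝓔.Step C.1 f (C.next e he').1 := by
          have : C.next e he' = C.next f hf' := congrArg (fun t : LTrans 𝓔.Conf L => t.2.2) h
          rw [this]; exact mem_enabled_iff.1 hf'
        exact Step.unique (mem_enabled_iff.1 he') h4
    · rintro e ⟨heR, he⟩ heM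
      obtain ⟨_, hm⟩ := (mem_events_iff hR).1 heR
      obtain ⟨t', ht', hc⟩ := h3 _ hm fun h => heM ((mem_events_iff hM).2 ⟨he, h⟩)
      obtain ⟨f, hf, rfl⟩ := hev t' (hM ht')
      refine ⟨f, (mem_events_iff hM).2 ⟨hf, ht'⟩, ?_⟩
      rw [immConc_trans_iff] at hc
      by_contra hcon
      refine hc ⟨?_, hcon⟩
      rintro rfl
      exact heM ((mem_events_iff hM).2 ⟨hf, ht'⟩)

variable (𝓔) in
/-- Passing from a local process to the class of its node is a bounded morphism. -/
theorem morphism_cls_nodeOf :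
    ModalFrame.Morphism 𝓔.toTSI.frame 𝓔.classFrame 𝓔.localProcs fun H => (𝓔.nodeOf H).cls where
  rel_dom := by
    rintro (_ | ⟨_ | _, a⟩) w w' h
    · exact h.1
    · exact h.1
    · exact h.1
  sub := fun H h => h.1
  total := rfl
  forth := by
    -- Both action diamonds at once; they differ only in the hypothesis on `freeEvents`.
    have act : ∀ (b : Bool) H r, H ∈ 𝓔.localProcs → r ∈ H.1 →
        (∀ e, 𝓔.Step r.src.1 e r.tgt.1 → (e ∈ 𝓔.freeEvents H.2 ↔ b = false)) →
        (𝓔.toTSI.maxSet r.tgt, some r) ∈ 𝓔.localProcs ∧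
        𝓔.classFrame.rel (some (b, r.lab)) (𝓔.nodeOf H).cls
          (𝓔.nodeOf (𝓔.toTSI.maxSet r.tgt, some r)).cls := by
      intro b H r hH hr hb
      obtain ⟨hrT, hsrc⟩ := hH.2 hr
      refine ⟨⟨⟨⟨_, Or.inl rfl⟩, hrT⟩, subset_rfl⟩, classFrame_rel_iff.2 ⟨_, ?_, rfl⟩⟩
      obtain ⟨e, hl, he⟩ := hrT
      have he' : 𝓔.Step (𝓔.target H.2).1 e r.tgt.1 := by rw [← hsrc]; exact he
      exact ⟨e, ⟨r, hr, he⟩, he', hl.symm, hb e he,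
        congrArg (fun C : 𝓔.Conf => 𝓔.enabled C.1) hsrc, events_maxSet _⟩
    rintro (_ | ⟨_ | _, a⟩) H H' hH h
    · obtain ⟨h1, M, h2, h3, rfl⟩ := h
      have hM : M ⊆ 𝓔.toTSI.maxSet (𝓔.target H.2) := h3.2.2.1.trans hH.2
      refine ⟨⟨⟨h2, h1.2⟩, hM⟩, classFrame_rel_iff.2 ⟨𝓔.nodeOf (M, H.2), ⟨rfl, rfl, ?_⟩, rfl⟩⟩
      exact (maxTrace_events_iff hH.2 hM).2
        ((𝓔.toTSI.completeTrace_iff h1.1 hH.2).1 ⟨h2, h3⟩)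
    · obtain ⟨h1, r, h2, rfl, h3, rfl⟩ := h
      refine act false H r hH h2 fun e he => ?_
      obtain ⟨hrT, hsrc⟩ := hH.2 h2
      simpa using (causal_iff h1.2 hrT hsrc he).2.1 h3
    · obtain ⟨h1, r, h2, rfl, h3, rfl⟩ := h
      refine act true H r hH h2 fun e he => ?_
      obtain ⟨hrT, hsrc⟩ := hH.2 h2
      simpa using (causal_iff h1.2 hrT hsrc he).1.1 h3
  back := by
    intro m H q hH hq
    obtain ⟨ν', h, rfl⟩ := classFrame_rel_iff.1 hq
    clear hq
    match m, h with
    | some (b, a), h =>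
      obtain ⟨e, he, hs, rfl, hb, hf, hsup⟩ := h
      obtain ⟨hee, hm⟩ := (mem_events_iff hH.2).1 he
      obtain ⟨hrT, hsrc⟩ := hH.2 hm
      have hnode : 𝓔.nodeOf (𝓔.toTSI.maxSet (trans _ e hee).tgt, some (trans _ e hee)) = ν' := by
        obtain ⟨conf, free, sup⟩ := ν'
        have h1 : Conf.next _ e hee = conf := Subtype.ext hs.2.2.2.symm
        simp only at hf hsup
        subst hf hsup h1
        simp only [nodeOf, events_maxSet]
        rfl
      have hci := causal_iff hH.1.2 hrT hsrc (mem_enabled_iff.1 hee)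
      refine ⟨(𝓔.toTSI.maxSet (trans _ e hee).tgt, some (trans _ e hee)),
        ⟨⟨⟨_, Or.inl rfl⟩, hrT⟩, subset_rfl⟩, ?_, congrArg Node.cls hnode⟩
      cases b
      · exact ⟨hH.1, _, hm, rfl, hci.2.2 (hb.2 rfl), rfl⟩
      · exact ⟨hH.1, _, hm, rfl, hci.1.2 (fun h => by simpa using hb.1 h), rfl⟩
    | none, h =>
      obtain ⟨hc, hf, hM⟩ := h
      -- The given trace of events, realised by transitions from the current configuration.
      set M : Set (LTrans 𝓔.Conf L) :=
        {r | r ∈ 𝓔.toTSI.maxSet (𝓔.target H.2) ∧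
          ∃ e ∈ ν'.sup, 𝓔.Step r.src.1 e r.tgt.1} with hMdef
      have hMs : M ⊆ 𝓔.toTSI.maxSet (𝓔.target H.2) := fun r hr => hr.1
      have hev : 𝓔.events M = ν'.sup := by
        ext e
        rw [mem_events_iff hMs]
        constructor
        · rintro ⟨h1, h2, e', h3, h4⟩
          rwa [Step.unique (mem_enabled_iff.1 h1) h4]
        · intro h
          have h1 := (hM.1 h).2
          exact ⟨h1, trans_mem h1, e, h, mem_enabled_iff.1 h1⟩
      have hM' : 𝓔.MaxTrace (𝓔.target H.2).1 (𝓔.events M) (𝓔.events H.1) := by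
        rw [hev]; exact hM
      obtain ⟨h1, h2⟩ := (𝓔.toTSI.completeTrace_iff hH.1.1 hH.2).2
        ((maxTrace_events_iff hH.2 hMs).1 hM')
      refine ⟨(M, H.2), ⟨⟨h1, hH.1.2⟩, hMs⟩, ⟨hH.1, M, h1, h2, rfl⟩, congrArg Node.cls ?_⟩
      obtain ⟨conf, free, sup⟩ := ν'
      simp only at hc hf hev
      subst hc hf
      simp only [nodeOf, hev]

end EventStructure

/-! ### Recursion on Gödel numbers -/

/-- `Nat.pair a b` is at least `a + b`. With tag `0` the payload can equal the number, which is why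
`foldCode` treats tag `0` as a leaf. -/
theorem Nat.unpair_snd_lt {n : ℕ} (h : n.unpair.1 ≠ 0) : n.unpair.2 < n := by
  have := Nat.add_le_pair n.unpair.1 n.unpair.2
  rw [Nat.pair_unpair] at this
  omega

/-- Recursion on Gödel numbers of formulae. The function `f` receives the tag, the payload and the
values at the payload and at its two components. -/
def foldCode {σ : Type*} (f : ℕ → ℕ → σ → σ → σ → σ) (d : σ) (n : ℕ) : σ :=
  if h : n.unpair.1 = 0 then f 0 n.unpair.2 d d d
  else
    have := Nat.unpair_snd_lt h
    have := n.unpair.2.unpair_left_le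
    have := n.unpair.2.unpair_right_le
    f n.unpair.1 n.unpair.2 (foldCode f d n.unpair.2) (foldCode f d n.unpair.2.unpair.1)
      (foldCode f d n.unpair.2.unpair.2)
termination_by n
decreasing_by all_goals omega

theorem foldCode_zero {σ : Type*} (f : ℕ → ℕ → σ → σ → σ → σ) (d : σ) (p : ℕ) :
    foldCode f d (Nat.pair 0 p) = f 0 p d d d := by
  rw [foldCode]; simp

theorem foldCode_succ {σ : Type*} (f : ℕ → ℕ → σ → σ → σ → σ) (d : σ) (t p : ℕ) :
    foldCode f d (Nat.pair (t + 1) p) = f (t + 1) p (foldCode f d p)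
      (foldCode f d p.unpair.1) (foldCode f d p.unpair.2) := by
  rw [foldCode]; simp

/-- The Gödel number with a given tag, from the payload and the numbers of the subformulae. -/
def rebuildCode (t p v v₁ v₂ : ℕ) : ℕ :=
  if t = 1 ∨ t = 5 then Nat.pair t v
  else if t = 2 then Nat.pair t (Nat.pair v₁ v₂)
  else Nat.pair t (Nat.pair p.unpair.1 v₂)

/-- Substitution on Gödel numbers. -/
def substCode (Z χ : ℕ) : ℕ → ℕ :=
  foldCode (fun t p v v₁ v₂ =>
    if t = 0 then if p = Z then χ else Nat.pair 0 p
    else if t = 6 then Nat.pair 6 p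
    else rebuildCode t p v v₁ v₂) 0

/-- The Gödel number of `TFL.bot`. -/
def botCode : ℕ := Nat.pair 2 (Nat.pair (Nat.pair 0 0) (Nat.pair 1 (Nat.pair 0 0)))

/-- Unfolding of fixpoints on Gödel numbers. -/
def unfoldCode (K : ℕ) : ℕ → ℕ :=
  foldCode (fun t p v v₁ v₂ =>
    if t = 0 then Nat.pair 0 p
    else if t = 6 then (fun χ => substCode p.unpair.1 χ v₂)^[K] botCode
    else rebuildCode t p v v₁ v₂) 0

namespace TFL

variable {L : Type v} [Encodable L]

theorem code_subst (Z : ℕ) (χ : TFL L) (φ : TFL L) :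
    (subst Z χ φ).code = substCode Z χ.code φ.code := by
  induction φ with
  | var Y =>
    simp only [subst, code, substCode, foldCode_zero]
    split_ifs <;> rfl
  | neg φ ih => simp only [subst, code, ih, substCode]; rw [foldCode_succ]; simp [rebuildCode]
  | and φ ψ ih₁ ih₂ =>
    simp only [subst, code, ih₁, ih₂, substCode]; rw [foldCode_succ]; simp [rebuildCode]
  | diaC a φ ih => simp only [subst, code, ih, substCode]; rw [foldCode_succ]; simp [rebuildCode]
  | diaNC a φ ih =>
    simp only [subst, code, ih, substCode]; rw [foldCode_succ]; simp [rebuildCode]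
  | diaT φ ih => simp only [subst, code, ih, substCode]; rw [foldCode_succ]; simp [rebuildCode]
  | mu Y φ _ => simp only [subst, code, substCode]; rw [foldCode_succ]; simp

/-- The algorithm sees formulae only as numbers and learns `K` during the run, so it must unfold on
Gödel numbers. -/
theorem code_unfold (K : ℕ) (φ : TFL L) : (unfold K φ).code = unfoldCode K φ.code := by
  induction φ with
  | var Y => simp only [unfold, code, unfoldCode, foldCode_zero]; simp
  | neg φ ih => simp only [unfold, code, ih, unfoldCode]; rw [foldCode_succ]; simp [rebuildCode]
  | and φ ψ ih₁ ih₂ =>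
    simp only [unfold, code, ih₁, ih₂, unfoldCode]; rw [foldCode_succ]; simp [rebuildCode]
  | diaC a φ ih => simp only [unfold, code, ih, unfoldCode]; rw [foldCode_succ]; simp [rebuildCode]
  | diaNC a φ ih =>
    simp only [unfold, code, ih, unfoldCode]; rw [foldCode_succ]; simp [rebuildCode]
  | diaT φ ih => simp only [unfold, code, ih, unfoldCode]; rw [foldCode_succ]; simp [rebuildCode]
  | mu Z φ ih =>
    have : ∀ n, ((fun χ => subst Z χ (unfold K φ))^[n] bot).code =
        (fun χ => substCode Z χ (unfold K φ).code)^[n] botCode := by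
      intro n
      induction n with
      | zero => rfl
      | succ n ihn => rw [Function.iterate_succ_apply', Function.iterate_succ_apply', code_subst, ihn]
    simp only [unfold, this, ih]
    simp only [code, unfoldCode]
    rw [foldCode_succ]
    simp

end TFL

/-! ### Exploration of the configurations -/

/-- The sequences of at most `n` events, last event first, that can be executed according to the
table `g` of next events. -/
def paths (g : List ℕ → List ℕ) : ℕ → List (List ℕ)
  | 0 => [[]]
  | n + 1 => paths g n ++ (paths g n).flatMap fun c => (g c).map fun e => e :: c

theorem paths_subset_succ (g : List ℕ → List ℕ) (n : ℕ) : paths g n ⊆ paths g (n + 1) :=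
  List.subset_append_left _ _

theorem paths_mono (g : List ℕ → List ℕ) {m n : ℕ} (h : m ≤ n) : paths g m ⊆ paths g n := by
  induction h with
  | refl => exact List.Subset.refl _
  | step _ ih => exact List.Subset.trans ih (paths_subset_succ g _)

theorem nil_mem_paths (g : List ℕ → List ℕ) (n : ℕ) : [] ∈ paths g n :=
  paths_mono g (Nat.zero_le n) (List.mem_singleton.2 rfl)

theorem mem_paths_succ {g : List ℕ → List ℕ} {n : ℕ} {c : List ℕ} :
    c ∈ paths g (n + 1) ↔ c ∈ paths g n ∨ ∃ d ∈ paths g n, ∃ e ∈ g d, e :: d = c := by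
  simp [paths]

theorem cons_mem_paths {g : List ℕ → List ℕ} {n : ℕ} {c : List ℕ} (hc : c ∈ paths g n) {e : ℕ}
    (he : e ∈ g c) : e :: c ∈ paths g (n + 1) :=
  mem_paths_succ.2 (Or.inr ⟨c, hc, e, he, rfl⟩)

/-- Paths of length `n + 1` consult the table only at paths of length at most `n`, hence the extra
unit in the range of `m`. -/
theorem paths_congr {g g' : List ℕ → List ℕ} {n : ℕ} (h : ∀ c ∈ paths g n, g' c = g c) :
    ∀ m ≤ n + 1, paths g' m = paths g m := by
  intro m
  induction m with
  | zero => intro _; rfl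
  | succ m ih =>
    intro hm
    have hpm := ih (by omega)
    simp only [paths, hpm]
    congr 1
    apply List.flatMap_congr
    intro c hc
    rw [h c (paths_mono g (by omega) hc)]

/-- The sublists of a list. -/
def powerlists (l : List ℕ) : List (List ℕ) :=
  l.foldr (fun e acc => acc ++ acc.map fun m => e :: m) [[]]

theorem powerlists_cons (e : ℕ) (l : List ℕ) :
    powerlists (e :: l) = powerlists l ++ (powerlists l).map fun m => e :: m := rfl

theorem subset_of_mem_powerlists {l m : List ℕ} (h : m ∈ powerlists l) : m ⊆ l := by
  induction l generalizing m with
  | nil => rw [List.mem_singleton.1 h]; exact List.Subset.refl _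
  | cons e l ih =>
    rw [powerlists_cons, List.mem_append, List.mem_map] at h
    rcases h with h | ⟨m', h, rfl⟩
    · exact List.subset_cons_of_subset _ (ih h)
    · exact List.cons_subset_cons _ (ih h)

theorem self_mem_powerlists (l : List ℕ) : l ∈ powerlists l := by
  induction l with
  | nil => exact List.mem_singleton.2 rfl
  | cons e l ih =>
    rw [powerlists_cons]
    exact List.mem_append_right _ (List.mem_map.2 ⟨l, ih, rfl⟩)

/-- Filtering `l` gives such a sublist. It ensures that the node list contains a representative of
every set of enabled events. -/
theorem exists_mem_powerlists (l : List ℕ) (P : ℕ → Prop) :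
    ∃ m ∈ powerlists l, ∀ x, x ∈ m ↔ x ∈ l ∧ P x := by
  induction l with
  | nil => exact ⟨[], List.mem_singleton.2 rfl, by simp⟩
  | cons e l ih =>
    obtain ⟨m, hm, h⟩ := ih
    by_cases he : P e
    · refine ⟨e :: m, ?_, fun x => ?_⟩
      · rw [powerlists_cons]
        exact List.mem_append_right _ (List.mem_map.2 ⟨m, hm, rfl⟩)
      · rw [List.mem_cons, List.mem_cons, h]
        constructor
        · rintro (rfl | h)
          · exact ⟨Or.inl rfl, he⟩
          · exact ⟨Or.inr h.1, h.2⟩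
        · rintro ⟨rfl | h, h'⟩
          · exact Or.inl rfl
          · exact Or.inr ⟨h, h'⟩
    · refine ⟨m, List.mem_append_left _ hm, fun x => ?_⟩
      rw [List.mem_cons, h]
      constructor
      · exact fun h => ⟨Or.inr h.1, h.2⟩
      · rintro ⟨rfl | h, h'⟩
        · exact absurd h' he
        · exact ⟨h, h'⟩

/-! ### Evaluation of formulae without fixpoints on finitely many nodes -/

/-- Is the event `e` independent of the last event of `c`? -/
def indepBool (g : List ℕ → List ℕ) (c : List ℕ) (e : ℕ) : Bool :=
  decide (c ≠ []) && (g c.tail).any fun x => decide (x = e)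

/-- Are the events `e` and `f`, both enabled after `c`, in conflict? -/
def conflictBool (g : List ℕ → List ℕ) (c : List ℕ) (e f : ℕ) : Bool :=
  !decide (e = f) && !(g (e :: c)).any fun x => decide (x = f)

/-- Is `m` a maximal conflict-free part of `l`, a list of events enabled after `c`? -/
def traceBool (g : List ℕ → List ℕ) (c m l : List ℕ) : Bool :=
  (m.all fun e => (l.any fun x => decide (x = e)) && m.all fun f => !conflictBool g c e f) &&
  l.all fun e => (m.any fun x => decide (x = e)) || m.any fun f => conflictBool g c e f

/-- Can the node `w` move into the set `S` by an event with the label `a`, independent of the last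
event iff `b` holds? -/
def actBool (g : List ℕ → List ℕ) (h : ℕ → ℕ) (b : Bool) (a : ℕ) (S : List (List ℕ × List ℕ))
    (w : List ℕ × List ℕ) : Bool :=
  w.2.any fun e => (decide (h e = a) && decide (indepBool g w.1 e = b)) &&
    S.any fun x => decide (x = (e :: w.1, g (e :: w.1)))

/-- Does the node `w` have a complete trace in the set `S`? -/
def traceDiaBool (g : List ℕ → List ℕ) (S : List (List ℕ × List ℕ)) (w : List ℕ × List ℕ) :
    Bool :=
  (powerlists (g w.1)).any fun m => traceBool g w.1 m w.2 &&
    S.any fun x => decide (x = (w.1, m))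

/-- Does the node `w` satisfy a formula, given its tag and payload and the sets of nodes that
satisfy its subformulae? -/
def evalBool (g : List ℕ → List ℕ) (h : ℕ → ℕ) (t p : ℕ) (v v₁ v₂ : List (List ℕ × List ℕ))
    (w : List ℕ × List ℕ) : Bool :=
  if t = 1 then !v.any fun x => decide (x = w)
  else if t = 2 then (v₁.any fun x => decide (x = w)) && v₂.any fun x => decide (x = w)
  else if t = 3 then actBool g h false p.unpair.1 v₂ w
  else if t = 4 then actBool g h true p.unpair.1 v₂ w
  else if t = 5 then traceDiaBool g v w
  else false

theorem any_decide_eq {α : Type*} [DecidableEq α] (l : List α) (a : α) :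
    (l.any fun x => decide (x = a)) = decide (a ∈ l) := by
  rw [Bool.eq_iff_iff]
  simp

/-- The nodes over paths of length at most `N`. -/
def nodeList (g : List ℕ → List ℕ) (N : ℕ) : List (List ℕ × List ℕ) :=
  (paths g N).flatMap fun c => (powerlists (g c)).map fun m => (c, m)

/-- The nodes among `U` that satisfy the formula with the given Gödel number. -/
def evalCode (g : List ℕ → List ℕ) (h : ℕ → ℕ) (U : List (List ℕ × List ℕ)) :
    ℕ → List (List ℕ × List ℕ) :=
  foldCode (fun t p v v₁ v₂ => U.filter fun w => evalBool g h t p v v₁ v₂ w) []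

theorem mem_nodeList {g : List ℕ → List ℕ} {N : ℕ} {c m : List ℕ} :
    (c, m) ∈ nodeList g N ↔ c ∈ paths g N ∧ m ∈ powerlists (g c) := by
  simp [nodeList]

theorem ListsSet.unique {E : Type u} [Encodable E] {l : List ℕ} {A B : Set E}
    (hA : ListsSet l A) (hB : ListsSet l B) : A = B := by
  have aux : ∀ {A B : Set E}, ListsSet l A → ListsSet l B → A ⊆ B := by
    intro A B hA hB e he
    obtain ⟨f, hf, h⟩ := (hB _).1 ((hA _).2 ⟨e, he, rfl⟩)
    rwa [← Encodable.encode_injective h]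
  exact (aux hA hB).antisymm (aux hB hA)

theorem ListsSet.encode_mem {E : Type u} [Encodable E] {l : List ℕ} {A : Set E}
    (hA : ListsSet l A) {e : E} : Encodable.encode e ∈ l ↔ e ∈ A := by
  rw [hA]
  exact ⟨fun ⟨f, hf, h⟩ => Encodable.encode_injective h ▸ hf, fun h => ⟨e, h, rfl⟩⟩

/-! ### Correctness of the evaluation on paths -/

namespace EventStructure

variable {E : Type u} {L : Type v} [Encodable E] {𝓔 : EventStructure E L}

variable (𝓔) in
/-- The table `g` correctly lists the next events for all paths of length at most `n`. -/
def CorrectNext (g : List ℕ → List ℕ) (n : ℕ) : Prop :=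
  ∀ c ∈ paths g n, ∀ C : 𝓔.Conf, ListsSet c C.1 → ListsSet (g c) (𝓔.enabled C.1)

theorem listsSet_next {c : List ℕ} {C : 𝓔.Conf} (h : ListsSet c C.1) {e : E}
    (he : e ∈ 𝓔.enabled C.1) : ListsSet (Encodable.encode e :: c) (C.next e he).1 := by
  intro n
  rw [List.mem_cons, h]
  constructor
  · rintro (rfl | ⟨f, hf, rfl⟩)
    · exact ⟨e, Or.inl rfl, rfl⟩
    · exact ⟨f, Or.inr hf, rfl⟩
  · rintro ⟨f, rfl | hf, rfl⟩
    · exact Or.inl rfl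
    · exact Or.inr ⟨f, hf, rfl⟩

theorem listsSet_nil : ListsSet [] 𝓔.initConf.1 := by
  intro n
  simp [initConf]

/-- Every path leads to a configuration. -/
theorem CorrectNext.exists_conf {g : List ℕ → List ℕ} {n : ℕ} (h : 𝓔.CorrectNext g n) :
    ∀ m ≤ n + 1, ∀ c ∈ paths g m, ∃ C : 𝓔.Conf, ListsSet c C.1 := by
  intro m
  induction m with
  | zero =>
    intro _ c hc
    rw [List.mem_singleton.1 hc]
    exact ⟨_, listsSet_nil⟩
  | succ m ih =>
    intro hm c hc
    rcases mem_paths_succ.1 hc with hc | ⟨d, hd, e, he, rfl⟩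
    · exact ih (by omega) c hc
    · obtain ⟨C, hC⟩ := ih (by omega) d hd
      obtain ⟨f, hf, rfl⟩ := (h d (paths_mono g (by omega) hd) C hC e).1 he
      exact ⟨_, listsSet_next hC hf⟩

/-- The pair `(c, m)` represents the node `ν`. -/
structure NodeRep (g : List ℕ → List ℕ) (c m : List ℕ) (ν : 𝓔.Node) : Prop where
  conf : ListsSet c ν.conf.1
  free : ∀ e ∈ 𝓔.enabled ν.conf.1, e ∈ ν.free ↔ indepBool g c (Encodable.encode e) = true
  sup : ∀ e ∈ 𝓔.enabled ν.conf.1, e ∈ ν.sup ↔ Encodable.encode e ∈ m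

/-- The successor is represented by exactly the pair that `actBool` looks up. Its events come from
the table at a path one longer, so correctness up to `j + 1` is needed. -/
theorem NodeRep.step {g : List ℕ → List ℕ} {N j : ℕ} (hg : 𝓔.CorrectNext g N) (hj : j + 1 ≤ N)
    {c m : List ℕ} (hc : c ∈ paths g j) {ν ν' : 𝓔.Node} (h : NodeRep g c m ν) {e : E}
    (hs : 𝓔.Step ν.conf.1 e ν'.conf.1) (hf : ν'.free = 𝓔.enabled ν.conf.1)
    (hsup : ν'.sup = 𝓔.enabled ν'.conf.1) :
    Encodable.encode e :: c ∈ paths g (j + 1) ∧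
      NodeRep g (Encodable.encode e :: c) (g (Encodable.encode e :: c)) ν' := by
  have he : e ∈ 𝓔.enabled ν.conf.1 := ⟨_, hs⟩
  have hgc := hg c (paths_mono g (by omega) hc) ν.conf h.conf
  have hmem := cons_mem_paths hc (hgc.encode_mem.2 he)
  have hconf : ListsSet (Encodable.encode e :: c) ν'.conf.1 := by
    have := listsSet_next h.conf he
    rw [hs.2.2.2]
    exact this
  refine ⟨hmem, hconf, ?_, ?_⟩
  · intro x _
    rw [hf, ← hgc.encode_mem]
    simp [indepBool]
  · intro x _
    rw [hsup]
    exact (hg _ (paths_mono g hj hmem) ν'.conf hconf).encode_mem.symm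

/-- Conflict is not given by a program, but for enabled events it is visible: by
`mem_enabled_insert_iff`, a distinct event disappears from the next events after `e` exactly if it
is in conflict with `e`. -/
theorem conflictBool_iff {g : List ℕ → List ℕ} {N j : ℕ} (hg : 𝓔.CorrectNext g N)
    (hj : j + 1 ≤ N) {c : List ℕ} (hc : c ∈ paths g j) {C : 𝓔.Conf} (h : ListsSet c C.1)
    {e f : E} (he : e ∈ 𝓔.enabled C.1) (hf : f ∈ 𝓔.enabled C.1) :
    conflictBool g c (Encodable.encode e) (Encodable.encode f) = true ↔ 𝓔.conflict e f := by
  have hgc := hg c (paths_mono g (by omega) hc) C h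
  have hmem := cons_mem_paths hc (hgc.encode_mem.2 he)
  have h1 := (hg _ (paths_mono g hj hmem) _ (listsSet_next h he)).encode_mem (e := f)
  have h2 := mem_enabled_insert_iff he hf
  have h3 : f ∈ 𝓔.enabled (C.next e he).1 ↔ e ≠ f ∧ ¬ 𝓔.conflict e f := h2
  have h4 : e = f → ¬ 𝓔.conflict e f := by rintro rfl; exact 𝓔.conflict_irrefl e
  simp only [conflictBool, Bool.and_eq_true, Bool.not_eq_true', decide_eq_false_iff_not,
    Encodable.encode_inj, List.any_eq_false, decide_eq_true_eq]
  have h5 : (∀ x ∈ g (Encodable.encode e :: c), ¬ x = Encodable.encode f) ↔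
      ¬ Encodable.encode f ∈ g (Encodable.encode e :: c) :=
    ⟨fun h hm => h _ hm rfl, fun h x hx hxe => h (hxe ▸ hx)⟩
  rw [h5, h1, h3]
  tauto

/-- The inclusions in `g c` ensure that every listed number codes an enabled event, so the tests on
lists are the clauses of `MaxTrace`. -/
theorem traceBool_iff {g : List ℕ → List ℕ} {N j : ℕ} (hg : 𝓔.CorrectNext g N)
    (hj : j + 1 ≤ N) {c m l : List ℕ} (hc : c ∈ paths g j) {C : 𝓔.Conf} (h : ListsSet c C.1)
    (hm : m ⊆ g c) (hl : l ⊆ g c) {M R : Set E}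
    (hM : M ⊆ 𝓔.enabled C.1) (hmM : ∀ e ∈ 𝓔.enabled C.1, e ∈ M ↔ Encodable.encode e ∈ m)
    (hlR : ∀ e ∈ 𝓔.enabled C.1, e ∈ R ↔ Encodable.encode e ∈ l) :
    traceBool g c m l = true ↔ 𝓔.MaxTrace C.1 M R := by
  have hgc := hg c (paths_mono g (by omega) hc) C h
  have hev : ∀ x ∈ g c, ∃ e ∈ 𝓔.enabled C.1, Encodable.encode e = x := fun x hx => (hgc x).1 hx
  simp only [traceBool, Bool.and_eq_true, List.all_eq_true, List.any_eq_true, decide_eq_true_eq,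
    exists_eq_right, Bool.not_eq_true', Bool.or_eq_true]
  constructor
  · rintro ⟨h1, h2⟩
    refine ⟨fun e he => ⟨(hlR e (hM he)).2 (h1 _ ((hmM e (hM he)).1 he)).1, hM he⟩, ?_, ?_⟩
    · intro e he f hf hef
      have := (h1 _ ((hmM e (hM he)).1 he)).2 _ ((hmM f (hM hf)).1 hf)
      rw [(conflictBool_iff hg hj hc h (hM he) (hM hf)).2 hef] at this
      exact absurd this (by simp)
    · rintro e ⟨heR, he⟩ heM
      rcases h2 _ ((hlR e he).1 heR) with h3 | ⟨x, hx, h3⟩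
      · exact absurd ((hmM e he).2 h3) heM
      · obtain ⟨f, hf, rfl⟩ := hev x (hm hx)
        exact ⟨f, (hmM f hf).2 hx, (conflictBool_iff hg hj hc h he hf).1 h3⟩
  · rintro ⟨h1, h2, h3⟩
    refine ⟨fun x hx => ?_, fun x hx => ?_⟩
    · obtain ⟨e, he, rfl⟩ := hev x (hm hx)
      have heM := (hmM e he).2 hx
      refine ⟨(hlR e he).1 (h1 heM).1, fun y hy => ?_⟩
      obtain ⟨f, hf, rfl⟩ := hev y (hm hy)
      rw [← Bool.not_eq_true, conflictBool_iff hg hj hc h he hf]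
      exact h2 e heM f ((hmM f hf).2 hy)
    · obtain ⟨e, he, rfl⟩ := hev x (hl hx)
      by_cases heM : e ∈ M
      · exact Or.inl ((hmM e he).1 heM)
      · obtain ⟨f, hf, hef⟩ := h3 e ⟨(hlR e he).2 hx, he⟩ heM
        exact Or.inr ⟨_, (hmM f (hM hf)).1 hf, (conflictBool_iff hg hj hc h he (hM hf)).2 hef⟩

theorem traceDiaBool_iff {g : List ℕ → List ℕ} {N j : ℕ} (hg : 𝓔.CorrectNext g N)
    (hj : j + 1 ≤ N) {c m : List ℕ} (hc : c ∈ paths g j)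
    (hm : m ∈ powerlists (g c)) {ν : 𝓔.Node} (hν : NodeRep g c m ν)
    {S : List (List ℕ × List ℕ)} {X : Set 𝓔.NodeClass}
    (hS : ∀ m ∈ powerlists (g c), ∀ ν : 𝓔.Node, NodeRep g c m ν →
      ((c, m) ∈ S ↔ ν.cls ∈ X)) :
    traceDiaBool g S (c, m) = true ↔ ν.cls ∈ 𝓔.classFrame.dia none X := by
  have hcN := paths_mono g (by omega : j ≤ N) hc
  have hgc := hg c hcN ν.conf hν.conf
  simp only [traceDiaBool, List.any_eq_true, Bool.and_eq_true, decide_eq_true_eq, exists_eq_right]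
  constructor
  · rintro ⟨m', hm', htr, hS'⟩
    set M : Set E := {e | e ∈ 𝓔.enabled ν.conf.1 ∧ Encodable.encode e ∈ m'}
    have hM : ∀ e ∈ 𝓔.enabled ν.conf.1, e ∈ M ↔ Encodable.encode e ∈ m' :=
      fun e he => ⟨fun h => h.2, fun h => ⟨he, h⟩⟩
    have hrep : NodeRep g c m' (⟨ν.conf, ν.free, M⟩ : 𝓔.Node) := ⟨hν.conf, hν.free, hM⟩
    refine ⟨_, classFrame_rel_iff.2 ⟨⟨ν.conf, ν.free, M⟩, ⟨rfl, rfl, ?_⟩, rfl⟩,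
      (hS m' hm' _ hrep).1 hS'⟩
    exact (traceBool_iff hg hj hc hν.conf (subset_of_mem_powerlists hm')
      (subset_of_mem_powerlists hm) (fun e he => he.1) hM hν.sup).1 htr
  · rintro ⟨q, hq, hqX⟩
    obtain ⟨⟨conf, free, M⟩, ⟨hc', hf, hM⟩, rfl⟩ := classFrame_rel_iff.1 hq
    simp only at hc' hf hM
    subst hc' hf
    -- An abstract trace is realised by filtering the list of next events.
    obtain ⟨m', hm', hmem⟩ :=
      exists_mem_powerlists (g c) fun x => ∃ e ∈ M, Encodable.encode e = x
    have hM' : ∀ e ∈ 𝓔.enabled ν.conf.1, e ∈ M ↔ Encodable.encode e ∈ m' := by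
      intro e he
      rw [hmem]
      exact ⟨fun h => ⟨hgc.encode_mem.2 he, e, h, rfl⟩,
        fun ⟨_, f, hf, h⟩ => Encodable.encode_injective h ▸ hf⟩
    refine ⟨m', hm', ?_, (hS m' hm' ⟨ν.conf, ν.free, M⟩ ⟨hν.conf, hν.free, hM'⟩).2 hqX⟩
    exact (traceBool_iff hg hj hc hν.conf (subset_of_mem_powerlists hm')
      (subset_of_mem_powerlists hm) (fun e he => (hM.1 he).2) hM' hν.sup).2 hM

variable [Encodable L]

variable (𝓔) in
/-- The function `h` correctly computes the labels of the events that occur next on paths of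
length at most `n`. -/
def CorrectLabel (g : List ℕ → List ℕ) (h : ℕ → ℕ) (n : ℕ) : Prop :=
  ∀ c ∈ paths g n, ∀ e : E, Encodable.encode e ∈ g c →
    h (Encodable.encode e) = Encodable.encode (𝓔.lab e)

/-- The negation of `b` appears because causal moves use dependent events. The successor carries the
full list of next events, which belongs to its own `powerlists`. -/
theorem actBool_iff {g : List ℕ → List ℕ} {h : ℕ → ℕ} {N j : ℕ} (hg : 𝓔.CorrectNext g N)
    (hh : 𝓔.CorrectLabel g h N) (hj : j + 1 ≤ N) {c m : List ℕ} (hc : c ∈ paths g j)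
    (hm : m ∈ powerlists (g c)) {ν : 𝓔.Node} (hν : NodeRep g c m ν) {b : Bool} {a : L}
    {S : List (List ℕ × List ℕ)} {X : Set 𝓔.NodeClass}
    (hS : ∀ c ∈ paths g (j + 1), ∀ m ∈ powerlists (g c), ∀ ν : 𝓔.Node, NodeRep g c m ν →
      ((c, m) ∈ S ↔ ν.cls ∈ X)) :
    actBool g h (!b) (Encodable.encode a) S (c, m) = true ↔
      ν.cls ∈ 𝓔.classFrame.dia (some (b, a)) X := by
  have hcN := paths_mono g (by omega : j ≤ N) hc
  have hgc := hg c hcN ν.conf hν.conf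
  simp only [actBool, List.any_eq_true, Bool.and_eq_true, decide_eq_true_eq, exists_eq_right]
  constructor
  · rintro ⟨x, hx, ⟨hl, hb⟩, hxS⟩
    have hxg := subset_of_mem_powerlists hm hx
    obtain ⟨e, he, rfl⟩ := (hgc x).1 hxg
    rw [hh c hcN e hxg, Encodable.encode_inj] at hl
    set ν' : 𝓔.Node := ⟨ν.conf.next e he, 𝓔.enabled ν.conf.1, 𝓔.enabled (ν.conf.next e he).1⟩
    obtain ⟨h1, h2⟩ := hν.step (ν' := ν') hg hj hc (mem_enabled_iff.1 he) rfl rfl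
    refine ⟨ν'.cls, classFrame_rel_iff.2 ⟨ν', ⟨e, (hν.sup e he).2 hx, mem_enabled_iff.1 he, hl,
      ?_, rfl, rfl⟩, rfl⟩, (hS _ h1 _ (self_mem_powerlists _) _ h2).1 hxS⟩
    rw [hν.free e he, hb]
    cases b <;> simp
  · rintro ⟨q, hq, hqX⟩
    obtain ⟨ν', ⟨e, hes, hs, hl, hb, hf, hsup⟩, rfl⟩ := classFrame_rel_iff.1 hq
    have he : e ∈ 𝓔.enabled ν.conf.1 := ⟨_, hs⟩
    obtain ⟨h1, h2⟩ := hν.step hg hj hc hs hf hsup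
    refine ⟨Encodable.encode e, (hν.sup e he).1 hes, ⟨?_, ?_⟩,
      (hS _ h1 _ (self_mem_powerlists _) _ h2).2 hqX⟩
    · rw [hh c hcN e (hgc.encode_mem.2 he), hl]
    · rw [hν.free e he] at hb
      cases b
      · simpa using hb
      · simpa using hb

/-- The evaluation is correct at all nodes whose distance from the end of the exploration is at
least the Gödel number of the formula. -/
theorem mem_evalCode_iff {g : List ℕ → List ℕ} {h : ℕ → ℕ} {N : ℕ} (hg : 𝓔.CorrectNext g N)
    (hh : 𝓔.CorrectLabel g h N) (ψ : TFL L) : ψ.FixFree → ∀ j, j + ψ.code ≤ N →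
    ∀ c ∈ paths g j, ∀ m ∈ powerlists (g c), ∀ ν : 𝓔.Node, NodeRep g c m ν →
      ((c, m) ∈ evalCode g h (nodeList g N) ψ.code ↔
        ν.cls ∈ 𝓔.classFrame.sem ψ fun _ => ∅) := by
  have hU : ∀ j ≤ N, ∀ c ∈ paths g j, ∀ m ∈ powerlists (g c), (c, m) ∈ nodeList g N :=
    fun j hj c hc m hm => mem_nodeList.2 ⟨paths_mono g hj hc, hm⟩
  induction ψ with
  | var Z =>
    intro _ j hj c hc m hm ν hν
    simp only [TFL.code, evalCode, foldCode_zero, ModalFrame.sem]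
    -- No test applies to tag `0`, so variables hold nowhere, in agreement with the empty valuation.
    simp [evalBool]
  | neg φ ih =>
    intro hψ j hj c hc m hm ν hν
    rw [TFL.code] at hj
    have := Nat.add_le_pair 1 φ.code
    have ih' := ih hψ j (by omega) c hc m hm ν hν
    simp only [TFL.code, evalCode, ModalFrame.sem] at ih' ⊢
    rw [foldCode_succ]
    simp only [List.mem_filter, hU j (by omega) c hc m hm, evalBool, true_and, if_true,
      Set.mem_sdiff, ← ih', any_decide_eq]
    simp [classFrame]
  | and φ ψ ih₁ ih₂ =>
    intro hψ j hj c hc m hm ν hν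
    rw [TFL.code] at hj
    have := Nat.add_le_pair 2 (Nat.pair φ.code ψ.code)
    have := Nat.add_le_pair φ.code ψ.code
    have ih₁' := ih₁ hψ.1 j (by omega) c hc m hm ν hν
    have ih₂' := ih₂ hψ.2 j (by omega) c hc m hm ν hν
    simp only [TFL.code, evalCode, ModalFrame.sem] at ih₁' ih₂' ⊢
    rw [foldCode_succ]
    simp only [List.mem_filter, hU j (by omega) c hc m hm, evalBool, true_and, Set.mem_inter_iff,
      ← ih₁', ← ih₂']
    simp
  | diaC a φ ih =>
    intro hψ j hj c hc m hm ν hν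
    rw [TFL.code] at hj
    -- The Gödel number drops by at least `3`, which pays for the path growing by one event.
    have := Nat.add_le_pair 3 (Nat.pair (Encodable.encode a) φ.code)
    have := Nat.add_le_pair (Encodable.encode a) φ.code
    have key := actBool_iff (b := true) (a := a) hg hh (by omega) hc hm hν
      (ih hψ (j + 1) (by omega))
    simp only [TFL.code, evalCode, ModalFrame.sem] at key ⊢
    rw [foldCode_succ, ← key]
    simp [List.mem_filter, hU j (by omega) c hc m hm, evalBool]
  | diaNC a φ ih =>
    intro hψ j hj c hc m hm ν hν
    rw [TFL.code] at hj
    have := Nat.add_le_pair 4 (Nat.pair (Encodable.encode a) φ.code)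
    have := Nat.add_le_pair (Encodable.encode a) φ.code
    have key := actBool_iff (b := false) (a := a) hg hh (by omega) hc hm hν
      (ih hψ (j + 1) (by omega))
    simp only [TFL.code, evalCode, ModalFrame.sem] at key ⊢
    rw [foldCode_succ, ← key]
    simp [List.mem_filter, hU j (by omega) c hc m hm, evalBool]
  | diaT φ ih =>
    intro hψ j hj c hc m hm ν hν
    rw [TFL.code] at hj
    have := Nat.add_le_pair 5 φ.code
    have key := traceDiaBool_iff hg (by omega) hc hm hν (ih hψ j (by omega) c hc)
    simp only [TFL.code, evalCode, ModalFrame.sem] at key ⊢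
    rw [foldCode_succ, ← key]
    simp [List.mem_filter, hU j (by omega) c hc m hm, evalBool]
  | mu Z φ _ => intro hψ; exact hψ.elim

end EventStructure

/-! ### The number of classes of nodes -/

/-- A bound on the number of classes of nodes, computed from the paths of length at most `n` and
those of length at most `n + 1`. -/
def classBound (l l' : List (List ℕ)) : ℕ :=
  l.length * (2 ^ l'.flatten.length * 2 ^ l'.flatten.length)

namespace EventStructure

variable {E : Type u} {L : Type v} [Encodable E] {𝓔 : EventStructure E L}

/-- If every path of length `n + 1` leads to a configuration with the same future as one that is
reached by a path of length at most `n`, then this holds for all configurations. -/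
theorem exists_path_futIso {g : List ℕ → List ℕ} {n : ℕ} (hg : 𝓔.CorrectNext g n)
    (h : ∀ c ∈ paths g (n + 1), ∀ C : 𝓔.Conf, ListsSet c C.1 →
      ∃ d ∈ paths g n, ∃ D : 𝓔.Conf, ListsSet d D.1 ∧ 𝓔.SameFuture C.1 D.1) (C : 𝓔.Conf) :
    ∃ d ∈ paths g n, ∃ D : 𝓔.Conf, ListsSet d D.1 ∧ ∃ ρ, 𝓔.FutIso C.1 D.1 ρ := by
  obtain ⟨C, hC⟩ := C
  induction hC with
  | refl => exact ⟨[], nil_mem_paths g n, 𝓔.initConf, listsSet_nil, _, FutIso.refl _⟩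
  | @tail B C hB hs ih =>
    obtain ⟨e, he⟩ := hs
    obtain ⟨d, hd, D, hdD, ρ, hρ⟩ := ih
    have heB : e ∈ 𝓔.enabled B := ⟨_, he⟩
    obtain ⟨e', hee'⟩ := hρ.total (enabled_subset_future heB)
    have heD := (hρ.enabled_iff he.1 D.isConf hee').1 heB
    -- The extension of `d` by the image of `e` is a path of length at most `n + 1`; the covering
    -- hypothesis shortens it.
    obtain ⟨d', hd', D', hdD', hsf⟩ := h _
      (cons_mem_paths hd ((hg d hd D hdD).encode_mem.2 heD)) _ (listsSet_next hdD heD)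
    obtain ⟨σ, hσ⟩ := hsf.exists_futIso
    have hC : 𝓔.FutIso C (D.next e' heD).1 _ := he.2.2.2 ▸ hρ.insert hee'
    exact ⟨d', hd', D', hdD', _, hC.trans hσ⟩

/-- A class is determined by a path leading to an isomorphic future and by the two sets of enabled
events, transported along the isomorphism. The path is one of finitely many, and the sets may be
taken among the subsets of a finite set of numbers. -/
theorem card_nodeClass_le {g : List ℕ → List ℕ} {n : ℕ} (hg : 𝓔.CorrectNext g n)
    (h : ∀ C : 𝓔.Conf, ∃ d ∈ paths g n, ∃ D : 𝓔.Conf, ListsSet d D.1 ∧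
      ∃ ρ, 𝓔.FutIso C.1 D.1 ρ) :
    Finite 𝓔.NodeClass ∧ Nat.card 𝓔.NodeClass ≤ classBound (paths g n) (paths g (n + 1)) := by
  classical
  set F := (paths g (n + 1)).flatten.toFinset with hF
  set T := (paths g n).toFinset ×ˢ (F.powerset ×ˢ F.powerset) with hT
  let conf : List ℕ → 𝓔.Conf := fun c =>
    if h : ∃ C : 𝓔.Conf, ListsSet c C.1 then h.choose else 𝓔.initConf
  let θ : T → 𝓔.NodeClass := fun x => Node.cls ⟨conf x.1.1, {e | Encodable.encode e ∈ x.1.2.1},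
    {e | Encodable.encode e ∈ x.1.2.2}⟩
  have hθ : Function.Surjective θ := by
    intro q
    obtain ⟨ν, rfl⟩ : ∃ ν : 𝓔.Node, ν.cls = q := Quotient.exists_rep q
    obtain ⟨d, hd, D, hdD, ρ, hρ⟩ := h ν.conf
    have hconf : conf d = D := by
      have hex : ∃ C : 𝓔.Conf, ListsSet d C.1 := ⟨D, hdD⟩
      simp only [conf, dif_pos hex]
      exact Subtype.ext (hex.choose_spec.unique hdD)
    -- The transported set, as a set of numbers. Intersecting with `F` loses no enabled event.
    let code : Set E → Finset ℕ := fun A =>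
      {x ∈ F | ∃ e, Encodable.encode e = x ∧ ∃ a ∈ A, ρ a e}
    have hcode : ∀ A x y, ρ x y → x ∈ 𝓔.enabled ν.conf.1 →
        (x ∈ A ↔ Encodable.encode y ∈ code A) := by
      intro A x y hxy hx
      have hy := (hρ.enabled_iff ν.conf.isConf D.isConf hxy).1 hx
      -- An event enabled after a path of length at most `n` occurs in a path of length at most `n +
      -- 1`; hence the choice of `F`.
      have hyF : Encodable.encode y ∈ F := by
        have h1 := (hg d hd D hdD).encode_mem.2 hy
        rw [hF, List.mem_toFinset, List.mem_flatten]
        exact ⟨_, cons_mem_paths hd h1, List.mem_cons_self⟩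
      simp only [code, Finset.mem_filter, hyF, true_and]
      constructor
      · exact fun hA => ⟨y, rfl, x, hA, hxy⟩
      · rintro ⟨y', hyy, x', hx', hxy'⟩
        obtain rfl := Encodable.encode_injective hyy
        rwa [hρ.left_unique hxy hxy']
    refine ⟨⟨(d, code ν.free, code ν.sup), ?_⟩, Eq.symm (Node.cls_eq.2 ⟨ρ, ?_, ?_⟩)⟩
    · simp only [hT, Finset.mem_product, List.mem_toFinset, Finset.mem_powerset, hd, true_and]
      exact ⟨Finset.filter_subset _ _, Finset.filter_subset _ _⟩
    · simp only [hconf]; exact hρ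
    · exact fun x y hxy hx => ⟨hcode _ x y hxy hx, hcode _ x y hxy hx⟩
  refine ⟨Finite.of_surjective θ hθ, (Nat.card_le_card_of_surjective θ hθ).trans ?_⟩
  rw [Nat.card_eq_fintype_card, Fintype.card_coe, hT, Finset.card_product, Finset.card_product,
    Finset.card_powerset, classBound]
  have h1 : F.card ≤ (paths g (n + 1)).flatten.length := List.toFinset_card_le _
  have h2 : 2 ^ F.card ≤ 2 ^ (paths g (n + 1)).flatten.length :=
    Nat.pow_le_pow_right (by norm_num) h1
  exact Nat.mul_le_mul (List.toFinset_card_le _) (Nat.mul_le_mul h2 h2)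

/-- Correctness of the evaluation of the unfolded formula. -/
theorem mem_evalCode_unfold_iff [Encodable L] {g : List ℕ → List ℕ} {h : ℕ → ℕ} {n : ℕ}
    (hg : 𝓔.CorrectNext g n)
    (hn : ∀ c ∈ paths g (n + 1), ∀ C : 𝓔.Conf, ListsSet c C.1 →
      ∃ d ∈ paths g n, ∃ D : 𝓔.Conf, ListsSet d D.1 ∧ 𝓔.SameFuture C.1 D.1)
    {φ : TFL L} (hwf : φ.WellFormed) (hcl : φ.Closed) {ψ : ℕ}
    (hψ : ψ = unfoldCode (classBound (paths g n) (paths g (n + 1))) φ.code)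
    (hgN : 𝓔.CorrectNext g ψ) (hhN : 𝓔.CorrectLabel g h ψ)
    (V : ℕ → Set (TSI.Proc 𝓔.Conf L)) :
    ([], g []) ∈ evalCode g h (nodeList g ψ) ψ ↔ 𝓔.toTSI.initProc ∈ 𝓔.toTSI.denot φ V := by
  obtain ⟨hfin, hcard⟩ := card_nodeClass_le hg (exists_path_futIso hg hn)
  rw [← TFL.code_unfold] at hψ
  have hinit : 𝓔.toTSI.initProc ∈ 𝓔.localProcs :=
    ⟨⟨⟨_, Or.inl rfl⟩, trivial⟩, subset_rfl⟩
  have hrep : NodeRep g [] (g []) (𝓔.nodeOf 𝓔.toTSI.initProc) := by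
    refine ⟨listsSet_nil, fun e _ => ?_, fun e he => ?_⟩
    · simp [nodeOf, TSI.initProc, freeEvents, indepBool]
    · have h1 := hgN [] (nil_mem_paths g _) 𝓔.initConf listsSet_nil
      rw [h1.encode_mem]
      simp only [nodeOf, TSI.initProc]
      rw [events_maxSet]
      rfl
  -- The number `ψ` is at once the formula and the depth of exploration, just enough for the empty
  -- path with `j = 0`.
  have h1 := mem_evalCode_iff hgN hhN (φ.unfold _) (TFL.fixFree_unfold _ φ) 0
    (by rw [zero_add, hψ]) [] (nil_mem_paths g 0) (g []) (self_mem_powerlists _) _ hrep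
  rw [← hψ, ModalFrame.sem_unfold rfl hcard φ hwf] at h1
  -- A closed formula ignores the valuation, and the empty valuations of both frames correspond
  -- under the morphism.
  rw [h1, ← TSI.sem_frame,
    ModalFrame.sem_congr φ V (fun _ => ∅) fun Z hZ => by rw [hcl] at hZ; exact hZ.elim]
  exact ((morphism_cls_nodeOf 𝓔).sem φ hwf (fun _ => ∅) (fun _ => ∅)
    (fun _ => Set.empty_subset _) (fun _ _ _ => Iff.rfl) _ hinit).symm

end EventStructure

/-! ### Primitive recursiveness -/

namespace Primrec

variable {α β γ σ : Type*} [Primcodable α] [Primcodable β] [Primcodable γ] [Primcodable σ]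

theorem list_any {f : α → List β} {p : α → β → Bool} (hf : Primrec f) (hp : Primrec₂ p) :
    Primrec fun a => (f a).any (p a) :=
  (list_foldr hf (const false) (h := fun a x => p a x.1 || x.2)
    (Primrec.or.comp (hp.comp fst (fst.comp snd)) (snd.comp snd)).to₂).of_eq
    fun a => by induction f a <;> simp [*]

theorem list_all {f : α → List β} {p : α → β → Bool} (hf : Primrec f) (hp : Primrec₂ p) :
    Primrec fun a => (f a).all (p a) :=
  (list_foldr hf (const true) (h := fun a x => p a x.1 && x.2)
    (Primrec.and.comp (hp.comp fst (fst.comp snd)) (snd.comp snd)).to₂).of_eq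
    fun a => by induction f a <;> simp [*]

theorem list_filter {f : α → List β} {p : α → β → Bool} (hf : Primrec f) (hp : Primrec₂ p) :
    Primrec fun a => (f a).filter (p a) :=
  (listFilterMap hf (g := fun a b => bif p a b then some b else none)
    (cond hp (option_some.comp snd) (const none)).to₂).of_eq fun a => by
      rw [← List.filterMap_eq_filter]
      congr 1
      funext b
      cases h : p a b <;> simp [Option.guard, h]

theorem comp_left {f : α → β → σ} (hf : Primrec₂ f) {g : γ → α} (hg : Primrec g) :
    Primrec₂ fun x => f (g x) :=
  (hf.comp (hg.comp fst) snd).to₂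

theorem nat_pair : Primrec₂ Nat.pair := Primrec₂.natPair

theorem decide_eq [DecidableEq β] {f g : α → β} (hf : Primrec f) (hg : Primrec g) :
    Primrec fun a => decide (f a = g a) :=
  (Primrec.eq.comp hf hg).decide

theorem unpair_fst {f : α → ℕ} (hf : Primrec f) : Primrec fun a => (f a).unpair.1 :=
  fst.comp (unpair.comp hf)

theorem unpair_snd {f : α → ℕ} (hf : Primrec f) : Primrec fun a => (f a).unpair.2 :=
  snd.comp (unpair.comp hf)

theorem two_pow {f : α → ℕ} (hf : Primrec f) : Primrec fun a => 2 ^ f a :=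
  (nat_iterate hf (const 1) (h := fun _ x => 2 * x) (nat_mul.comp (const 2) snd).to₂).of_eq
    fun a => by
      induction f a with
      | zero => rfl
      | succ n ih => rw [Function.iterate_succ_apply', ih, pow_succ, mul_comm]

/-- Recursion on Gödel numbers of formulae is primitive recursive. -/
theorem foldCode {f : α → ℕ → ℕ → σ → σ → σ → σ} {d : σ}
    (hf : Primrec fun x : α × ℕ × ℕ × σ × σ × σ =>
      f x.1 x.2.1 x.2.2.1 x.2.2.2.1 x.2.2.2.2.1 x.2.2.2.2.2) :
    Primrec₂ fun a n => _root_.foldCode (f a) d n := by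
  have hp : ∀ {g : α × List σ → ℕ × ℕ × σ × σ × σ}, Primrec g → Primrec fun x : α × List σ =>
      f x.1 (g x).1 (g x).2.1 (g x).2.2.1 (g x).2.2.2.1 (g x).2.2.2.2 := by
    intro g hg
    exact hf.comp (pair fst hg)
  have hl : Primrec fun x : α × List σ => x.2.length := list_length.comp snd
  have hn : Primrec fun x : α × List σ => x.2.length.unpair.2 := unpair_snd hl
  have hget : ∀ {g : α × List σ → ℕ}, Primrec g →
      Primrec fun x : α × List σ => x.2.getD (g x) d :=
    fun {g} hg => (list_getD d).comp (g := fun x : α × List σ => x.2) snd hg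
  -- Course-of-values recursion: `l` lists the values at all smaller numbers, so the argument is
  -- `l.length`.
  refine nat_strong_rec _
    (g := fun a l => some (if l.length.unpair.1 = 0 then f a 0 l.length.unpair.2 d d d
      else f a l.length.unpair.1 l.length.unpair.2 (l.getD l.length.unpair.2 d)
        (l.getD l.length.unpair.2.unpair.1 d) (l.getD l.length.unpair.2.unpair.2 d))) ?_ ?_
  · have h1 := hp (pair (const 0) (pair hn (const (d, d, d))))
    have h2 := hp (pair (unpair_fst hl) (pair hn (pair (hget hn)
      (pair (hget (unpair_fst hn)) (hget (unpair_snd hn))))))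
    exact option_some.comp (ite (Primrec.eq.comp (unpair_fst hl) (const 0)) h1 h2)
  · intro a n
    rw [_root_.foldCode]
    simp only [List.length_map, List.length_range]
    split_ifs with h
    · rfl
    · have h0 := Nat.unpair_snd_lt h
      have h1 := n.unpair.2.unpair_left_le
      have h2 := n.unpair.2.unpair_right_le
      simp [List.getD_eq_getElem?_getD, h0, h1.trans_lt h0, h2.trans_lt h0]

theorem rebuildCode : Primrec fun x : ℕ × ℕ × ℕ × ℕ × ℕ =>
    _root_.rebuildCode x.1 x.2.1 x.2.2.1 x.2.2.2.1 x.2.2.2.2 := by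
  have hp := fst.comp (snd (α := ℕ) (β := ℕ × ℕ × ℕ × ℕ))
  have hr := snd.comp (snd (α := ℕ) (β := ℕ × ℕ × ℕ × ℕ))
  unfold _root_.rebuildCode
  refine ite ((Primrec.eq.comp fst (const 1)).or (Primrec.eq.comp fst (const 5)))
    (nat_pair.comp fst (fst.comp hr)) (ite (Primrec.eq.comp fst (const 2))
      (nat_pair.comp fst (nat_pair.comp (fst.comp (snd.comp hr)) (snd.comp (snd.comp hr))))
      (nat_pair.comp fst (nat_pair.comp (unpair_fst hp) (snd.comp (snd.comp hr)))))

theorem substCode : Primrec fun x : (ℕ × ℕ) × ℕ => _root_.substCode x.1.1 x.1.2 x.2 := by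
  have ht := fst.comp (snd (α := ℕ × ℕ) (β := ℕ × ℕ × ℕ × ℕ × ℕ))
  have hp := fst.comp (snd.comp (snd (α := ℕ × ℕ) (β := ℕ × ℕ × ℕ × ℕ × ℕ)))
  refine foldCode (α := ℕ × ℕ) (d := 0) (f := fun a t p v v₁ v₂ =>
    if t = 0 then if p = a.1 then a.2 else Nat.pair 0 p
    else if t = 6 then Nat.pair 6 p else _root_.rebuildCode t p v v₁ v₂) ?_
  exact ite (Primrec.eq.comp ht (const 0))
    (ite (Primrec.eq.comp hp (fst.comp fst)) (snd.comp fst) (nat_pair.comp (const 0) hp))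
    (ite (Primrec.eq.comp ht (const 6)) (nat_pair.comp (const 6) hp) (rebuildCode.comp snd))

theorem unfoldCode : Primrec₂ fun K n => _root_.unfoldCode K n := by
  have ht := fst.comp (snd (α := ℕ) (β := ℕ × ℕ × ℕ × ℕ × ℕ))
  have hp := fst.comp (snd.comp (snd (α := ℕ) (β := ℕ × ℕ × ℕ × ℕ × ℕ)))
  have hv := snd.comp (snd.comp (snd.comp (snd.comp (snd (α := ℕ) (β := ℕ × ℕ × ℕ × ℕ × ℕ)))))
  refine foldCode (α := ℕ) (d := 0) (f := fun K t p v v₁ v₂ =>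
    if t = 0 then Nat.pair 0 p
    else if t = 6 then (fun χ => _root_.substCode p.unpair.1 χ v₂)^[K] botCode
    else _root_.rebuildCode t p v v₁ v₂) ?_
  have hs : Primrec₂ fun (x : ℕ × ℕ × ℕ × ℕ × ℕ × ℕ) (χ : ℕ) =>
      _root_.substCode x.2.2.1.unpair.1 χ x.2.2.2.2.2 :=
    (substCode.comp (pair (pair ((unpair_fst hp).comp fst) snd) (hv.comp fst))).to₂
  have hi := nat_iterate fst (const botCode) hs
  exact ite (Primrec.eq.comp ht (const 0)) (nat_pair.comp (const 0) hp)
    (ite (Primrec.eq.comp ht (const 6)) hi (rebuildCode.comp snd))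

theorem paths {G : α → List ℕ → List ℕ} (hG : Primrec₂ G) {n : α → ℕ} (hn : Primrec n) :
    Primrec fun a => _root_.paths (G a) (n a) := by
  refine (nat_rec' hn (const [[]])
    (h := fun a x => x.2 ++ x.2.flatMap fun c => (G a c).map fun e => e :: c) ?_).of_eq ?_
  · have h1 : Primrec₂ fun (x : (α × ℕ × List (List ℕ)) × List ℕ) (e : ℕ) => e :: x.2 :=
      (list_cons.comp snd (snd.comp fst)).to₂
    have h2 : Primrec₂ fun (x : α × ℕ × List (List ℕ)) (c : List ℕ) =>
        (G x.1 c).map fun e => e :: c := list_map (hG.comp (fst.comp fst) snd) h1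
    have h3 : Primrec fun x : α × ℕ × List (List ℕ) => x.2.2 := snd.comp snd
    exact list_append.comp h3 (list_flatMap h3 h2)
  · intro a
    induction n a with
    | zero => rfl
    | succ n ih => simp only [ih, _root_.paths]

theorem powerlists : Primrec _root_.powerlists := by
  have h1 : Primrec₂ fun (x : List ℕ × ℕ × List (List ℕ)) (m : List ℕ) => x.2.1 :: m :=
    (list_cons.comp (fst.comp (snd.comp fst)) snd).to₂
  have h3 : Primrec fun x : List ℕ × ℕ × List (List ℕ) => x.2.2 := snd.comp snd
  have h4 : Primrec₂ fun (_ : List ℕ) (x : ℕ × List (List ℕ)) =>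
      x.2 ++ x.2.map fun m => x.1 :: m := list_append.comp h3 (list_map h3 h1)
  exact list_foldr .id (const [[]]) h4

theorem list_any_eq [DecidableEq β] {f : α → List β} {b : α → β} (hf : Primrec f)
    (hb : Primrec b) : Primrec fun a => (f a).any fun x => decide (x = b a) :=
  list_any hf (decide_eq snd (hb.comp fst)).to₂

theorem indepBool {G : α → List ℕ → List ℕ} (hG : Primrec₂ G) {c : α → List ℕ} {e : α → ℕ}
    (hc : Primrec c) (he : Primrec e) : Primrec fun a => _root_.indepBool (G a) (c a) (e a) :=
  Primrec.and.comp (Primrec.eq.comp hc (const [])).not.decide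
    (list_any_eq (hG.comp .id (list_tail.comp hc)) he)

theorem conflictBool {G : α → List ℕ → List ℕ} (hG : Primrec₂ G) {c : α → List ℕ} {e f : α → ℕ}
    (hc : Primrec c) (he : Primrec e) (hf : Primrec f) :
    Primrec fun a => _root_.conflictBool (G a) (c a) (e a) (f a) :=
  Primrec.and.comp (Primrec.not.comp (decide_eq he hf))
    (Primrec.not.comp (list_any_eq (hG.comp .id (list_cons.comp he hc)) hf))

theorem traceBool {G : α → List ℕ → List ℕ} (hG : Primrec₂ G) {c m l : α → List ℕ}
    (hc : Primrec c) (hm : Primrec m) (hl : Primrec l) :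
    Primrec fun a => _root_.traceBool (G a) (c a) (m a) (l a) := by
  have h1 : Primrec₂ fun (x : α × ℕ) (f : ℕ) => _root_.conflictBool (G x.1) (c x.1) x.2 f :=
    conflictBool (comp_left hG (fst.comp fst)) (hc.comp (fst.comp fst)) (snd.comp fst) snd
  have h2 : Primrec₂ fun (x : α × ℕ) (f : ℕ) => !_root_.conflictBool (G x.1) (c x.1) x.2 f :=
    Primrec.not.comp h1
  have h3 : Primrec fun x : α × ℕ => m x.1 := hm.comp fst
  have h4 : Primrec fun x : α × ℕ => l x.1 := hl.comp fst
  exact Primrec.and.comp (list_all hm (Primrec.and.comp (list_any_eq h4 snd) (list_all h3 h2)))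
    (list_all hl (Primrec.or.comp (list_any_eq h3 snd) (list_any h3 h1)))

theorem actBool {G : α → List ℕ → List ℕ} (hG : Primrec₂ G) {H : α → ℕ → ℕ} (hH : Primrec₂ H)
    (b : Bool) {l : α → ℕ} {S : α → List (List ℕ × List ℕ)} {w : α → List ℕ × List ℕ}
    (hl : Primrec l) (hS : Primrec S) (hw : Primrec w) :
    Primrec fun a => _root_.actBool (G a) (H a) b (l a) (S a) (w a) := by
  have hw1 : Primrec fun x : α × ℕ => (w x.1).1 := fst.comp (hw.comp fst)
  have hc : Primrec fun x : α × ℕ => x.2 :: (w x.1).1 := list_cons.comp snd hw1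
  have h1 : Primrec fun x : α × ℕ => decide (H x.1 x.2 = l x.1) :=
    decide_eq (hH.comp fst snd) (hl.comp fst)
  have h2 : Primrec fun x : α × ℕ => decide (_root_.indepBool (G x.1) (w x.1).1 x.2 = b) :=
    decide_eq (indepBool (comp_left hG fst) hw1 snd) (const b)
  have h3 : Primrec fun x : α × ℕ =>
      (S x.1).any fun y => decide (y = (x.2 :: (w x.1).1, G x.1 (x.2 :: (w x.1).1))) :=
    list_any_eq (hS.comp fst) (pair hc (hG.comp fst hc))
  exact list_any (snd.comp hw) (Primrec.and.comp (Primrec.and.comp h1 h2) h3)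

theorem traceDiaBool {G : α → List ℕ → List ℕ} (hG : Primrec₂ G)
    {S : α → List (List ℕ × List ℕ)} {w : α → List ℕ × List ℕ}
    (hS : Primrec S) (hw : Primrec w) :
    Primrec fun a => _root_.traceDiaBool (G a) (S a) (w a) := by
  have h1 : Primrec fun x : α × List ℕ =>
      _root_.traceBool (G x.1) (w x.1).1 x.2 (w x.1).2 :=
    traceBool (comp_left hG fst) (fst.comp (hw.comp fst)) snd (snd.comp (hw.comp fst))
  have h2 : Primrec fun x : α × List ℕ =>
      (S x.1).any fun y => decide (y = ((w x.1).1, x.2)) :=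
    list_any_eq (hS.comp fst) (pair (fst.comp (hw.comp fst)) snd)
  exact list_any (powerlists.comp (hG.comp .id (fst.comp hw))) (Primrec.and.comp h1 h2)

theorem nodeList {G : α → List ℕ → List ℕ} (hG : Primrec₂ G) {n : α → ℕ} (hn : Primrec n) :
    Primrec fun a => _root_.nodeList (G a) (n a) := by
  have h1 : Primrec₂ fun (x : α × List ℕ) (m : List ℕ) => (x.2, m) :=
    (pair (snd.comp fst) snd).to₂
  exact list_flatMap (paths hG hn) (list_map (powerlists.comp hG) h1)

theorem evalCode {G : α → List ℕ → List ℕ} (hG : Primrec₂ G) {H : α → ℕ → ℕ} (hH : Primrec₂ H)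
    {U : α → List (List ℕ × List ℕ)} (hU : Primrec U) :
    Primrec₂ fun a n => _root_.evalCode (G a) (H a) (U a) n := by
  refine foldCode (f := fun a t p v v₁ v₂ =>
    (U a).filter fun w => evalBool (G a) (H a) t p v v₁ v₂ w) (d := []) ?_
  refine list_filter (hU.comp fst) ?_
  have ht := fst.comp (snd.comp (fst (α := α × ℕ × ℕ × List (List ℕ × List ℕ) ×
    List (List ℕ × List ℕ) × List (List ℕ × List ℕ)) (β := List ℕ × List ℕ)))
  have hr := snd.comp (snd.comp (fst (α := α × ℕ × ℕ × List (List ℕ × List ℕ) ×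
    List (List ℕ × List ℕ) × List (List ℕ × List ℕ)) (β := List ℕ × List ℕ)))
  have hp := fst.comp hr
  have hv := fst.comp (snd.comp hr)
  have hv₁ := fst.comp (snd.comp (snd.comp hr))
  have hv₂ := snd.comp (snd.comp (snd.comp hr))
  have hG' := comp_left hG (fst.comp (fst (α := α × ℕ × ℕ × List (List ℕ × List ℕ) ×
    List (List ℕ × List ℕ) × List (List ℕ × List ℕ)) (β := List ℕ × List ℕ)))
  have hH' := comp_left hH (fst.comp (fst (α := α × ℕ × ℕ × List (List ℕ × List ℕ) ×
    List (List ℕ × List ℕ) × List (List ℕ × List ℕ)) (β := List ℕ × List ℕ)))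
  exact (ite (Primrec.eq.comp ht (const 1)) (Primrec.not.comp (list_any_eq hv snd))
    (ite (Primrec.eq.comp ht (const 2))
      (Primrec.and.comp (list_any_eq hv₁ snd) (list_any_eq hv₂ snd))
      (ite (Primrec.eq.comp ht (const 3)) (actBool hG' hH' false (unpair_fst hp) hv₂ snd)
        (ite (Primrec.eq.comp ht (const 4)) (actBool hG' hH' true (unpair_fst hp) hv₂ snd)
          (ite (Primrec.eq.comp ht (const 5)) (traceDiaBool hG' hv snd) (const false)))))).to₂

theorem classBound {l l' : α → List (List ℕ)} (hl : Primrec l) (hl' : Primrec l') :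
    Primrec fun a => _root_.classBound (l a) (l' a) :=
  have h := two_pow (list_length.comp (list_flatten.comp hl'))
  nat_mul.comp (list_length.comp hl) (nat_mul.comp h h)

end Primrec

/-! ### The algorithm -/

/-- The list of next events computed by the program `p` within `k` steps. -/
def runNext (k : ℕ) (p : Nat.Partrec.Code) (c : List ℕ) : Option (List ℕ) :=
  (p.evaln k (Encodable.encode c)).bind fun n => Encodable.decode n

/-- The table of next events computed within `k` steps. -/
def nextTable (k : ℕ) (p : Nat.Partrec.Code) (c : List ℕ) : List ℕ := (runNext k p c).getD []

/-- The table of labels computed within `k` steps. -/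
def labelTable (k : ℕ) (p : Nat.Partrec.Code) (e : ℕ) : ℕ := (p.evaln k e).getD 0

/-- Are `c` and `d` found equivalent within `k` steps? -/
def equivBool (k : ℕ) (p : Nat.Partrec.Code) (c d : List ℕ) : Bool :=
  decide (p.evaln k (Encodable.encode (c, d)) = some 1)

/-- Are `k` steps enough for listing the next events after all paths of length at most `n`? -/
def nextDone (k : ℕ) (p : Nat.Partrec.Code) (n : ℕ) : Bool :=
  (paths (nextTable k p) n).all fun c => (runNext k p c).isSome

/-- Are `k` steps enough for computing the labels of the events after paths of length at most
`n`? -/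
def labelDone (k : ℕ) (p p' : Nat.Partrec.Code) (n : ℕ) : Bool :=
  (paths (nextTable k p) n).all fun c => (nextTable k p c).all fun e => (p'.evaln k e).isSome

/-- Is every path of length at most `n + 1` found equivalent, within `k` steps, to one of length at
most `n`? -/
def coverDone (k : ℕ) (p p' : Nat.Partrec.Code) (n : ℕ) : Bool :=
  (paths (nextTable k p) (n + 1)).all fun c =>
    (paths (nextTable k p) n).any fun d => equivBool k p' c d

/-- The unfolding of a formula that suffices if the paths of length at most `n` cover all
classes. -/
def unfoldFor (k : ℕ) (p : Nat.Partrec.Code) (n φ : ℕ) : ℕ :=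
  unfoldCode (classBound (paths (nextTable k p) n) (paths (nextTable k p) (n + 1))) φ

/-- The model checker, with its bounds on the number of steps and on the length of paths coded
by `m`. -/
def modelCheck (x : Programs × ℕ) (m : ℕ) : Option Bool :=
  bif (nextDone m.unpair.1 x.1.1 m.unpair.2 && coverDone m.unpair.1 x.1.1 x.1.2.2 m.unpair.2) &&
    (nextDone m.unpair.1 x.1.1 (unfoldFor m.unpair.1 x.1.1 m.unpair.2 x.2) &&
      labelDone m.unpair.1 x.1.1 x.1.2.1 (unfoldFor m.unpair.1 x.1.1 m.unpair.2 x.2)) then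
    some ((evalCode (nextTable m.unpair.1 x.1.1) (labelTable m.unpair.1 x.1.2.1)
      (nodeList (nextTable m.unpair.1 x.1.1) (unfoldFor m.unpair.1 x.1.1 m.unpair.2 x.2))
      (unfoldFor m.unpair.1 x.1.1 m.unpair.2 x.2)).any fun w =>
        decide (w = ([], nextTable m.unpair.1 x.1.1 [])))
  else none

/-! ### Primitive recursiveness of the model checker -/

namespace Primrec

variable {α : Type*} [Primcodable α] {k : α → ℕ} {p p' : α → Nat.Partrec.Code}

theorem evaln {f : α → ℕ} (hk : Primrec k) (hp : Primrec p) (hf : Primrec f) :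
    Primrec fun a => (p a).evaln (k a) (f a) :=
  Nat.Partrec.Code.primrec_evaln.comp (pair (pair hk hp) hf)

theorem runNext (hk : Primrec k) (hp : Primrec p) :
    Primrec₂ fun a c => _root_.runNext (k a) (p a) c := by
  have h1 : Primrec₂ fun (_ : α × List ℕ) (n : ℕ) => (Encodable.decode n : Option (List ℕ)) :=
    Primrec.decode.comp snd
  exact option_bind (evaln (hk.comp fst) (hp.comp fst) (Primrec.encode.comp snd)) h1

theorem nextTable (hk : Primrec k) (hp : Primrec p) :
    Primrec₂ fun a c => _root_.nextTable (k a) (p a) c :=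
  option_getD.comp (runNext hk hp) (const [])

theorem labelTable (hk : Primrec k) (hp : Primrec p) :
    Primrec₂ fun a e => _root_.labelTable (k a) (p a) e :=
  option_getD.comp (evaln (hk.comp fst) (hp.comp fst) snd) (const 0)

theorem nextDone {n : α → ℕ} (hk : Primrec k) (hp : Primrec p) (hn : Primrec n) :
    Primrec fun a => _root_.nextDone (k a) (p a) (n a) :=
  list_all (paths (nextTable hk hp) hn) (option_isSome.comp (runNext hk hp))

theorem labelDone {n : α → ℕ} (hk : Primrec k) (hp : Primrec p) (hp' : Primrec p')
    (hn : Primrec n) : Primrec fun a => _root_.labelDone (k a) (p a) (p' a) (n a) := by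
  have h1 : Primrec₂ fun (x : α × List ℕ) (e : ℕ) => ((p' x.1).evaln (k x.1) e).isSome :=
    option_isSome.comp (evaln (hk.comp (fst.comp fst)) (hp'.comp (fst.comp fst)) snd)
  exact list_all (paths (nextTable hk hp) hn) (list_all (nextTable hk hp) h1)

theorem coverDone {n : α → ℕ} (hk : Primrec k) (hp : Primrec p) (hp' : Primrec p')
    (hn : Primrec n) : Primrec fun a => _root_.coverDone (k a) (p a) (p' a) (n a) := by
  have h1 : Primrec₂ fun (x : α × List ℕ) (d : List ℕ) => equivBool (k x.1) (p' x.1) x.2 d :=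
    decide_eq (evaln (hk.comp (fst.comp fst)) (hp'.comp (fst.comp fst))
      (Primrec.encode.comp (pair (snd.comp fst) snd))) (const (some 1))
  have h2 : Primrec fun x : α × List ℕ => _root_.paths (_root_.nextTable (k x.1) (p x.1)) (n x.1) :=
    (paths (nextTable hk hp) hn).comp fst
  exact list_all (paths (nextTable hk hp) (succ.comp hn)) (list_any h2 h1)

theorem unfoldFor {n φ : α → ℕ} (hk : Primrec k) (hp : Primrec p) (hn : Primrec n)
    (hφ : Primrec φ) : Primrec fun a => _root_.unfoldFor (k a) (p a) (n a) (φ a) :=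
  unfoldCode.comp (classBound (paths (nextTable hk hp) hn)
    (paths (nextTable hk hp) (succ.comp hn))) hφ

theorem modelCheck : Primrec₂ _root_.modelCheck := by
  have hk : Primrec fun y : (Programs × ℕ) × ℕ => y.2.unpair.1 := unpair_fst snd
  have hn : Primrec fun y : (Programs × ℕ) × ℕ => y.2.unpair.2 := unpair_snd snd
  have hp : Primrec fun y : (Programs × ℕ) × ℕ => y.1.1.1 := fst.comp (fst.comp fst)
  have hp₁ : Primrec fun y : (Programs × ℕ) × ℕ => y.1.1.2.1 :=
    fst.comp (snd.comp (fst.comp fst))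
  have hp₂ : Primrec fun y : (Programs × ℕ) × ℕ => y.1.1.2.2 :=
    snd.comp (snd.comp (fst.comp fst))
  have hψ := unfoldFor hk hp hn (snd.comp fst)
  have hg := nextTable hk hp
  exact cond (Primrec.and.comp
      (Primrec.and.comp (nextDone hk hp hn) (coverDone hk hp hp₂ hn))
      (Primrec.and.comp (nextDone hk hp hψ) (labelDone hk hp hp₁ hψ)))
    (option_some.comp (list_any_eq
      ((evalCode hg (labelTable hk hp₁) (nodeList hg hψ)).comp .id hψ)
      (pair (const []) (hg.comp .id (const [])))))
    (const none)

end Primrec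

/-! ### Correctness -/

/-- From some length on, longer paths reach no new classes of configurations. -/
theorem EventStructure.exists_cover {E : Type u} {L : Type v} [Encodable E]
    {𝓔 : EventStructure E L} (q : 𝓔.FiniteQuotient) {g : List ℕ → List ℕ}
    (hg : ∀ n, 𝓔.CorrectNext g n) :
    ∃ n, ∀ c ∈ paths g (n + 1), ∃ d ∈ paths g n, ∃ C D : 𝓔.Conf,
      ListsSet c C.1 ∧ ListsSet d D.1 ∧ q.rel C D := by
  have := q.finite_classes
  let S : ℕ →o Set (Quotient q.rel) :=
    ⟨fun n => {x | ∃ c ∈ paths g n, ∃ C : 𝓔.Conf, ListsSet c C.1 ∧ Quotient.mk q.rel C = x},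
      fun m n hmn x ⟨c, hc, hx⟩ => ⟨c, paths_mono g hmn hc, hx⟩⟩
  obtain ⟨n, hn⟩ := WellFoundedGT.monotone_chain_condition S
  refine ⟨n, fun c hc => ?_⟩
  obtain ⟨C, hC⟩ := (hg (n + 1)).exists_conf _ (Nat.le_succ _) c hc
  have hmem : Quotient.mk q.rel C ∈ S (n + 1) := ⟨c, hc, C, hC, rfl⟩
  rw [← hn (n + 1) (Nat.le_succ n)] at hmem
  obtain ⟨d, hd, D, hD, hDC⟩ := hmem
  exact ⟨d, hd, C, D, hC, hD, Quotient.exact hDC.symm⟩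

namespace IsPresentation

variable {E : Type u} {L : Type v} [Encodable E] [Encodable L] {p : Programs}
  {𝓔 : EventStructure E L} {q : 𝓔.FiniteQuotient}

/-- `evaln` returns only values of the single-valued `eval`, so the computed list is the promised
one. -/
theorem listsSet_runNext (hp : IsPresentation p 𝓔 q) {k : ℕ} {c l : List ℕ} {C : 𝓔.Conf}
    (hc : ListsSet c C.1) (h : runNext k p.1 c = some l) : ListsSet l (𝓔.enabled C.1) := by
  obtain ⟨l', hl', hs⟩ := hp.next C c hc
  obtain ⟨n, hn, hd⟩ := Option.bind_eq_some_iff.1 h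
  have hn' := Nat.Partrec.Code.evaln_sound (Option.mem_def.2 hn)
  rw [Part.mem_unique hn' hl', Encodable.encodek] at hd
  cases hd
  exact hs

/-- The test runs over the paths of the possibly incomplete table itself; when it succeeds, the
default value `[]` is not used at any of them. -/
theorem correctNext (hp : IsPresentation p 𝓔 q) {k n : ℕ} (h : nextDone k p.1 n = true) :
    𝓔.CorrectNext (nextTable k p.1) n := by
  intro c hc C hC
  obtain ⟨l, hl⟩ := Option.isSome_iff_exists.1 (List.all_eq_true.1 h c hc)
  rw [nextTable, hl]
  exact hp.listsSet_runNext hC hl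

theorem correctLabel (hp : IsPresentation p 𝓔 q) {k n : ℕ}
    (h : labelDone k p.1 p.2.1 n = true) :
    𝓔.CorrectLabel (nextTable k p.1) (labelTable k p.2.1) n := by
  intro c hc e he
  obtain ⟨a, ha⟩ :=
    Option.isSome_iff_exists.1 (List.all_eq_true.1 (List.all_eq_true.1 h c hc) _ he)
  rw [labelTable, ha]
  exact Part.mem_unique (Nat.Partrec.Code.evaln_sound (Option.mem_def.2 ha)) (hp.label e)

/-- For inequivalent configurations the program would answer `0`, and it cannot answer `1` as well.
-/
theorem rel_of_equivBool (hp : IsPresentation p 𝓔 q) {k : ℕ} {c d : List ℕ} {C D : 𝓔.Conf}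
    (hc : ListsSet c C.1) (hd : ListsSet d D.1) (h : equivBool k p.2.2 c d = true) :
    q.rel C D := by
  by_contra hn
  have h0 := (hp.equiv C D c d hc hd).2 hn
  have h1 := Nat.Partrec.Code.evaln_sound (Option.mem_def.2 (of_decide_eq_true h))
  exact absurd (Part.mem_unique h0 h1) (by norm_num)

/-- The tests certify everything that the evaluation relies on, so the answer is right whatever `m`
was accepted. -/
theorem modelCheck_sound (hp : IsPresentation p 𝓔 q) {φ : TFL L} (hwf : φ.WellFormed)
    (hcl : φ.Closed) {m : ℕ} {b : Bool} (h : modelCheck (p, φ.code) m = some b)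
    (V : ℕ → Set (TSI.Proc 𝓔.Conf L)) :
    b = true ↔ 𝓔.toTSI.initProc ∈ 𝓔.toTSI.denot φ V := by
  rw [modelCheck, Bool.cond_eq_ite, Option.ite_none_right_eq_some] at h
  obtain ⟨hcheck, hb⟩ := h
  simp only [Bool.and_eq_true] at hcheck
  obtain ⟨⟨h1, h2⟩, h3, h4⟩ := hcheck
  have hg := hp.correctNext h1
  rw [← EventStructure.mem_evalCode_unfold_iff hg ?_ hwf hcl rfl (hp.correctNext h3)
    (hp.correctLabel h4) V, ← Option.some.inj hb]
  · simp only [List.any_eq_true, decide_eq_true_eq, exists_eq_right]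
    rfl
  · intro c hc C hC
    obtain ⟨d, hd, hcd⟩ := List.any_eq_true.1 (List.all_eq_true.1 h2 c hc)
    obtain ⟨D, hD⟩ := hg.exists_conf _ (Nat.le_succ _) d hd
    exact ⟨d, hd, D, hD, q.sameFuture C D (hp.rel_of_equivBool hC hD hcd)⟩

theorem eventually_evaln {c : Nat.Partrec.Code} {n x : ℕ} (h : x ∈ c.eval n) :
    ∀ᶠ k in Filter.atTop, c.evaln k n = some x := by
  obtain ⟨k, hk⟩ := Nat.Partrec.Code.evaln_complete.1 h
  exact Filter.eventually_atTop.2 ⟨k, fun k' hk' => Nat.Partrec.Code.evaln_mono hk' hk⟩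

theorem eventually_forall_mem {β : Type*} {P : β → ℕ → Prop} (l : List β)
    (h : ∀ b ∈ l, ∀ᶠ k in Filter.atTop, P b k) : ∀ᶠ k in Filter.atTop, ∀ b ∈ l, P b k :=
  (Filter.eventually_all_finite l.finite_toSet).2 h

/-- For a suitable `n`, the run involves only finitely many computations, all of which halt, so a
single `k` is enough. -/
theorem modelCheck_complete (hp : IsPresentation p 𝓔 q) (φ : ℕ) :
    ∃ m b, modelCheck (p, φ) m = some b := by
  classical
  -- The table obtained with unlimited time. It depends on the list and not only on the
  -- configuration, since the program may order its output differently for another list.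
  let g : List ℕ → List ℕ := fun c =>
    if h : ∃ l : List ℕ, Encodable.encode l ∈ p.1.eval (Encodable.encode c) then h.choose else []
  have hg' : ∀ c (C : 𝓔.Conf), ListsSet c C.1 →
      Encodable.encode (g c) ∈ p.1.eval (Encodable.encode c) ∧
        ListsSet (g c) (𝓔.enabled C.1) := by
    intro c C hC
    obtain ⟨l, hl, hs⟩ := hp.next C c hC
    have hex : ∃ l : List ℕ, Encodable.encode l ∈ p.1.eval (Encodable.encode c) := ⟨l, hl⟩
    have hgc : g c = hex.choose := dif_pos hex
    have hmem := hex.choose_spec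
    rw [← hgc] at hmem
    refine ⟨hmem, ?_⟩
    rwa [Encodable.encode_injective (Part.mem_unique hmem hl)]
  have hg : ∀ n, 𝓔.CorrectNext g n := fun n c _ C hC => (hg' c C hC).2
  obtain ⟨n, hn⟩ := EventStructure.exists_cover q hg
  -- This depends on the ideal table and on `n`, but not on `k`, so `k` can be chosen last.
  set ψ := unfoldCode (classBound (paths g n) (paths g (n + 1))) φ with hψ
  have hconf : ∀ N, ∀ c ∈ paths g N, ∃ C : 𝓔.Conf, ListsSet c C.1 :=
    fun N => (hg N).exists_conf N (Nat.le_succ N)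
  have h1 := eventually_forall_mem (paths g (max n ψ))
    (P := fun c k => p.1.evaln k (Encodable.encode c) = some (Encodable.encode (g c)))
    fun c hc => by
      obtain ⟨C, hC⟩ := hconf _ c hc
      exact eventually_evaln (hg' c C hC).1
  have h2 := eventually_forall_mem (paths g ψ)
    (P := fun c k => ∀ e ∈ g c, (p.2.1.evaln k e).isSome = true) fun c hc => by
      obtain ⟨C, hC⟩ := hconf _ c hc
      refine eventually_forall_mem (g c) fun x hx => ?_
      obtain ⟨e, -, rfl⟩ := ((hg' c C hC).2 x).1 hx
      filter_upwards [eventually_evaln (hp.label e)] with k hk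
      rw [hk]; rfl
  have h3 := eventually_forall_mem (paths g (n + 1))
    (P := fun c k => ∃ d ∈ paths g n, equivBool k p.2.2 c d = true) fun c hc => by
      obtain ⟨d, hd, C, D, hC, hD, hCD⟩ := hn c hc
      filter_upwards [eventually_evaln ((hp.equiv C D c d hC hD).1 hCD)] with k hk
      exact ⟨d, hd, decide_eq_true hk⟩
  obtain ⟨k, h1, h2, h3⟩ := (h1.and (h2.and h3)).exists
  have hrun : ∀ c ∈ paths g (max n ψ), runNext k p.1 c = some (g c) := by
    intro c hc
    rw [runNext, h1 c hc, Option.bind_some, Encodable.encodek]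
  have htab : ∀ c ∈ paths g (max n ψ), nextTable k p.1 c = g c := by
    intro c hc
    rw [nextTable, hrun c hc]; rfl
  -- Agreement up to `max n ψ` gives equal paths one step further, as the covering test at `n + 1`
  -- requires.
  have hpaths := paths_congr htab
  have hpn := hpaths n (by omega)
  have hpn1 := hpaths (n + 1) (by omega)
  have hpψ := hpaths ψ (by omega)
  have hunf : unfoldFor k p.1 n φ = ψ := by rw [unfoldFor, hpn, hpn1]
  refine ⟨Nat.pair k n, ?_⟩
  have d1 : nextDone k p.1 n = true := by
    rw [nextDone, hpn, List.all_eq_true]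
    intro c hc
    rw [hrun c (paths_mono g (le_max_left _ _) hc)]; rfl
  have d2 : nextDone k p.1 ψ = true := by
    rw [nextDone, hpψ, List.all_eq_true]
    intro c hc
    rw [hrun c (paths_mono g (le_max_right _ _) hc)]; rfl
  have d3 : labelDone k p.1 p.2.1 ψ = true := by
    rw [labelDone, hpψ, List.all_eq_true]
    intro c hc
    rw [htab c (paths_mono g (le_max_right _ _) hc), List.all_eq_true]
    exact h2 c hc
  have d4 : coverDone k p.1 p.2.2 n = true := by
    rw [coverDone, hpn, hpn1, List.all_eq_true]
    intro c hc
    exact List.any_eq_true.2 (h3 c hc)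
  simp only [modelCheck, Nat.unpair_pair, hunf, d1, d2, d3, d4, Bool.and_self, cond_true]
  exact ⟨_, rfl⟩

end IsPresentation

theorem mainTheorem8 :
    ∃ alg : Programs × ℕ →. Bool, Partrec alg ∧
      ∀ (E : Type u) (L : Type v) [Encodable E] [Encodable L] (𝓔 : EventStructure E L)
        (q : 𝓔.FiniteQuotient) (p : Programs), IsPresentation p 𝓔 q →
        ∀ φ : TFL L, φ.WellFormed → φ.Closed →
          ∃ b ∈ alg (p, φ.code), ∀ V, 𝓔.toTSI.IsValuation V →
            (b = true ↔ 𝓔.toTSI.initProc ∈ 𝓔.toTSI.denot φ V) := by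
  -- Unbounded search for an accepted `m`. The one found may differ from the one known to exist, but
  -- any accepted one is sound.
  refine ⟨fun x => Nat.rfindOpt (modelCheck x), Partrec.rfindOpt Primrec.modelCheck.to_comp, ?_⟩
  intro E L _ _ 𝓔 q p hp φ hwf hcl
  obtain ⟨m, b, hmb⟩ := hp.modelCheck_complete φ.code
  obtain ⟨b', hb'⟩ := Part.dom_iff_mem.1 (Nat.rfindOpt_dom.2 ⟨m, b, hmb⟩)
  obtain ⟨m', hm'⟩ := Nat.rfindOpt_spec hb'
  exact ⟨b', hb', fun V _ => hp.modelCheck_sound hwf hcl hm' V⟩
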